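/- Let $N\ge 0$, and let $\mathcal A=\{1,\dots,N\}\sqcup\{\bar 1,\dots,\bar N\}$ be the alphabet of unbarred and barred letters; words in $\mathcal A$ are called colored words. A shuffle order is a total order $\lessdot$ on $\mathcal A$ with $1\lessdot\cdots\lessdot N$ and $\bar 1\lessdot\cdots\lessdot\bar N$; in particular we have the natural order $1<\bar 1<2<\bar 2<\cdots<N<\bar N$ and the big bar order $1\prec 2\prec\cdots\prec N\prec\bar 1\prec\bar 2\prec\cdots\prec\bar N$. Let $\mathcal U$ be the free associative $\mathbb Z$-algebra on $\mathcal A$, with the colored words as its basis of monomials. For $x\in\mathcal A$, let $x{\Downarrow}$ be the letter immediately below $x$ in the natural order ($1{\Downarrow}$ is undefined). Let $I_{\mathrm{kron}}\subseteq\mathcal U$ be the two-sided ideal corresponding to the relations $$yyx=yxy\ \ (y\text{ unbarred},\,x<y),\qquad zyy=yzy\ \ (y\text{ unbarred},\,y<z),$$ $$yyz=yzy\ \ (y\text{ barred},\,y<z),\qquad xyy=yxy\ \ (y\text{ barred},\,x<y),$$ $$(xz-zx)y=y(xz-zx)\ \ (x=y{\Downarrow}=z{\Downarrow}{\Downarrow}),\qquad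 xz=zx\ \ (x<z{\Downarrow}{\Downarrow}),$$ and let $(I_{\mathrm{kron}})^\perp$ be its orthogonal complement, in the (possibly infinite) formal sums of colored words, for the pairing under which colored words are orthonormal. A set $W$ of colored words is shuffle closed if for every $w\in W$, each word obtained from $w$ by swapping a barred letter with an adjacent unbarred letter also lies in $W$. For a partition $\nu$ and a shuffle order $\lessdot$, let $CT^{\lessdot}_\nu$ be the set of $\lessdot$-colored tableaux of shape $\nu$: fillings of the diagram of $\nu$ (English notation) by $\mathcal A$ whose rows and columns weakly increase for $\lessdot$, while the unbarred letters in each column and the barred letters in each row strictly increase. For such a filling $T$, the word $\mathrm{sqread}(T)$ is obtained by going through the diagonals of $T$ starting from the southwest, reading in each diagonal first the unbarred entries from southeast to northwest and then the barred entries from northwest to southeast. Conversion: if $\lessdot$ and $\lessdot'$ are shuffle orders that are identical except for the order of one unbarred letter $b$ and one barred letter $\bar a$, a $\lessdot$-colored tableau $T$ is converted to the $\lessdot'$-colored tableau obtained by refilling each connected component of the set of boxes containing $b$ or $\bar a$ with the same number of $b$'s and the same number of $\bar a$'s. For arbitrary shuffle orders $\lessdot,\lessdot'$, conversion is the iteration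 of this process along a sequence of such swaps leading from $\lessdot$ to $\lessdot'$. **Theorem.** Let $W$ be a shuffle closed set of colored words such that $\sum_{w\in W}w\in(I_{\mathrm{kron}})^\perp$, and let $\nu$ be a partition. Conversion from $\prec$ to $<$ is well defined: every $T\in CT^{\prec}_\nu$ can be converted along some sequence of swaps, and the resulting tableau $T^{\prec\to<}$ does not depend on the sequence of swaps. Moreover, $$\{T^{\prec\to<}\mid T\in CT^{\prec}_\nu,\ \mathrm{sqread}(T)\in W\}=\{T\in CT^{<}_\nu\mid \mathrm{sqread}(T)\in W\}.$$ -/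

import Mathlib

namespace ColoredTableaux

/-- The alphabet `𝒜 = {1, …, N} ⊔ {1̄, …, N̄}`. The element `a : Fin N` stands for the
number `a + 1`. -/
inductive Letter (N : ℕ) where
  | unbarred (a : Fin N) : Letter N
  | barred (a : Fin N) : Letter N
  deriving DecidableEq

/-- Whether a letter is barred. -/
def Letter.isBarred {N : ℕ} : Letter N → Bool
  | .unbarred _ => false
  | .barred _ => true

/-- Colored words. -/
abbrev Word (N : ℕ) : Type := List (Letter N)

/-! ### Shuffle orders -/

/-- A shuffle order: a (strict) total order on the alphabet with `1 ⋖ 2 ⋖ ⋯ ⋖ N` and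
`1̄ ⋖ 2̄ ⋖ ⋯ ⋖ N̄`. -/
@[ext]
structure ShuffleOrder (N : ℕ) where
  lt : Letter N → Letter N → Prop
  total : IsStrictTotalOrder (Letter N) lt
  unbarred_lt : ∀ a b : Fin N, a < b → lt (.unbarred a) (.unbarred b)
  barred_lt : ∀ a b : Fin N, a < b → lt (.barred a) (.barred b)

/-- Positions in `1 < 1̄ < 2 < 2̄ < ⋯ < N < N̄`. -/
def natRank {N : ℕ} : Letter N → ℕ
  | .unbarred a => 2 * a.val
  | .barred a => 2 * a.val + 1

/-- Positions in `1 ≺ 2 ≺ ⋯ ≺ N ≺ 1̄ ≺ 2̄ ≺ ⋯ ≺ N̄`. -/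
def bigBarRank {N : ℕ} : Letter N → ℕ
  | .unbarred a => a.val
  | .barred a => N + a.val

theorem natRank_injective {N : ℕ} : Function.Injective (natRank (N := N)) := by
  rintro (a | a) (b | b) h <;> simp only [natRank] at h
  · exact congrArg _ (Fin.ext (by omega))
  · omega
  · omega
  · exact congrArg _ (Fin.ext (by omega))

theorem bigBarRank_injective {N : ℕ} : Function.Injective (bigBarRank (N := N)) := by
  rintro (a | a) (b | b) h <;> simp only [bigBarRank] at h
  · exact congrArg _ (Fin.ext (by omega))
  · have := a.isLt
    omega
  · have := b.isLt
    omega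
  · exact congrArg _ (Fin.ext (by omega))

theorem isStrictTotalOrder_of_rank {N : ℕ} {r : Letter N → ℕ} (hr : Function.Injective r) :
    IsStrictTotalOrder (Letter N) (fun x y => r x < r y) where
  trichotomous _ _ h h' := hr (le_antisymm (not_lt.mp h') (not_lt.mp h))
  irrefl x := lt_irrefl (r x)
  trans _ _ _ h h' := lt_trans h h'

/-- The natural order `1 < 1̄ < 2 < 2̄ < ⋯ < N < N̄`. -/
def natOrder (N : ℕ) : ShuffleOrder N where
  lt x y := natRank x < natRank y
  total := isStrictTotalOrder_of_rank natRank_injective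
  unbarred_lt a b h := by
    have : a.val < b.val := h
    simp only [natRank]
    omega
  barred_lt a b h := by
    have : a.val < b.val := h
    simp only [natRank]
    omega

/-- The big bar order `1 ≺ 2 ≺ ⋯ ≺ N ≺ 1̄ ≺ 2̄ ≺ ⋯ ≺ N̄`. -/
def bigBarOrder (N : ℕ) : ShuffleOrder N where
  lt x y := bigBarRank x < bigBarRank y
  total := isStrictTotalOrder_of_rank bigBarRank_injective
  unbarred_lt a b h := by
    have : a.val < b.val := h
    simp only [bigBarRank]
    omega
  barred_lt a b h := by
    have : a.val < b.val := h
    simp only [bigBarRank]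
    omega

/-! ### The free algebra, the ideal of Kronecker relations, and orthogonality -/

/-- The free associative `ℤ`-algebra on the noncommuting variables `u_x`, `x ∈ 𝒜`,
with the colored words as its basis of monomials. -/
abbrev U (N : ℕ) : Type := MonoidAlgebra ℤ (FreeMonoid (Letter N))

/-- The variable `u_x`. -/
noncomputable def u {N : ℕ} (x : Letter N) : U N :=
  MonoidAlgebra.of ℤ (FreeMonoid (Letter N)) (FreeMonoid.of x)

/-- Going down by one in the natural order; undefined at the smallest letter `1`. -/
def down {N : ℕ} : Letter N → Option (Letter N)
  | .unbarred a => if a.val = 0 then none else some (.barred ⟨a.val - 1, by omega⟩)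
  | .barred a => some (.unbarred a)

/-- Going down by two in the natural order, where defined. -/
def down₂ {N : ℕ} (x : Letter N) : Option (Letter N) := (down x).bind down

/-- `KronRelator f`: the element `f` of the free algebra is the difference of the two sides of one
of the defining relations of the ideal `I_kron`. -/
inductive KronRelator {N : ℕ} : U N → Prop
  /-- `yyx = yxy` for `y` unbarred, `x < y`. -/
  | yyx (x y : Letter N) (hy : y.isBarred = false) (h : (natOrder N).lt x y) :
      KronRelator (u y * u y * u x - u y * u x * u y)
  /-- `zyy = yzy` for `y` unbarred, `y < z`. -/
  | zyy (y z : Letter N) (hy : y.isBarred = false) (h : (natOrder N).lt y z) :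
      KronRelator (u z * u y * u y - u y * u z * u y)
  /-- `yyz = yzy` for `y` barred, `y < z`. -/
  | yyz (y z : Letter N) (hy : y.isBarred = true) (h : (natOrder N).lt y z) :
      KronRelator (u y * u y * u z - u y * u z * u y)
  /-- `xyy = yxy` for `y` barred, `x < y`. -/
  | xyy (x y : Letter N) (hy : y.isBarred = true) (h : (natOrder N).lt x y) :
      KronRelator (u x * u y * u y - u y * u x * u y)
  /-- `(xz - zx)y = y(xz - zx)` for `x = y⇓ = z⇓⇓`. -/
  | rotate (x y z : Letter N) (hy : down y = some x) (hz : down₂ z = some x) :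
      KronRelator ((u x * u z - u z * u x) * u y - u y * (u x * u z - u z * u x))
  /-- `xz = zx` for `x < z⇓⇓`. -/
  | farCommute (x z z' : Letter N) (hz : down₂ z = some z') (h : (natOrder N).lt x z') :
      KronRelator (u x * u z - u z * u x)

/-- The two-sided ideal `I_kron` of `U`. -/
noncomputable def Ikron (N : ℕ) : TwoSidedIdeal (U N) := TwoSidedIdeal.span {f | KronRelator f}

/-- The pairing of a formal sum `∑ γ_w w` of colored words with an element of `U`, for which the
colored words are orthonormal. The formal sum may be infinite, since elements of `U` are finite
linear combinations of words; for finite sums this is the symmetric bilinear form on `U`. -/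
def pairing {N : ℕ} (γ : Word N → ℤ) (f : U N) : ℤ :=
  f.coeff.sum fun w c => γ w.toList * c

/-- The orthogonal complement `I^⊥` of a two-sided ideal, in the formal sums of colored words. -/
def perp {N : ℕ} (I : TwoSidedIdeal (U N)) : Set (Word N → ℤ) :=
  {γ | ∀ f ∈ I, pairing γ f = 0}

/-- The formal sum `∑_{w ∈ W} w`. -/
noncomputable def indicatorSum {N : ℕ} (W : Set (Word N)) : Word N → ℤ :=
  W.indicator 1

/-- `W` is closed under swapping a barred letter with an adjacent unbarred letter. -/
def ShuffleClosed {N : ℕ} (W : Set (Word N)) : Prop :=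
  ∀ (p s : Word N) (x y : Letter N), x.isBarred ≠ y.isBarred →
    p ++ [x, y] ++ s ∈ W → p ++ [y, x] ++ s ∈ W

/-! ### Colored tableaux -/

/-- Fillings of the diagram of `ν` (English convention: a box is `(row, column)`, numbered from 0)
by letters. -/
abbrev Filling (N : ℕ) (ν : YoungDiagram) : Type := ν → Letter N

/-- A filling is a `⋖`-colored tableau if rows and columns weakly increase for `⋖`, while
the unbarred letters in each column and the barred letters in each row strictly increase. -/
structure IsColored {N : ℕ} (o : ShuffleOrder N) {ν : YoungDiagram} (T : Filling N ν) : Prop where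
  row_weak : ∀ c c' : ν, c.1.1 = c'.1.1 → c.1.2 < c'.1.2 → T c = T c' ∨ o.lt (T c) (T c')
  col_weak : ∀ c c' : ν, c.1.2 = c'.1.2 → c.1.1 < c'.1.1 → T c = T c' ∨ o.lt (T c) (T c')
  row_strict : ∀ c c' : ν, c.1.1 = c'.1.1 → c.1.2 < c'.1.2 → (T c).isBarred = true → T c ≠ T c'
  col_strict : ∀ c c' : ν, c.1.2 = c'.1.2 → c.1.1 < c'.1.1 → (T c).isBarred = false → T c ≠ T c'

/-- The set `CT_ν^⋖` of `⋖`-colored tableaux of shape `ν`. -/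
def CT {N : ℕ} (o : ShuffleOrder N) (ν : YoungDiagram) : Set (Filling N ν) :=
  {T | IsColored o T}

/-! ### The reading word -/

/-- The boxes `(i, j)` of `ν` on the diagonal `j - i = k - ℓ`, where `ℓ` is the number of rows
of `ν`, listed from northwest to southeast. -/
def diagonal (ν : YoungDiagram) (k : ℕ) : List ν :=
  (List.range (ν.colLen 0) ×ˢ List.range (ν.rowLen 0)).filterMap fun c =>
    if h : c ∈ ν ∧ c.2 + ν.colLen 0 = c.1 + k then some ⟨c, h.1⟩ else none

/-- The unbarred letters of a diagonal read from southeast to northwest, followed by its barred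
letters read from northwest to southeast. -/
def diagonalWord {N : ℕ} {ν : YoungDiagram} (T : Filling N ν) (k : ℕ) : Word N :=
  ((diagonal ν k).reverse.map T).filter (fun x => !x.isBarred) ++
    ((diagonal ν k).map T).filter (fun x => x.isBarred)

/-- The reading word `sqread(T)`: the concatenation of the diagonal words, starting from
the southwest. -/
def sqread {N : ℕ} {ν : YoungDiagram} (T : Filling N ν) : Word N :=
  (List.range (ν.colLen 0 + ν.rowLen 0)).flatMap (diagonalWord T)

/-! ### Conversion -/

/-- `o` and `o'` are identical except for the order of the two letters `b` and `ā`, with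
`b` below `ā` for `o` and `ā` below `b` for `o'`. -/
def DifferBySwap {N : ℕ} (o o' : ShuffleOrder N) (b a : Fin N) : Prop :=
  o.lt (.unbarred b) (.barred a) ∧ o'.lt (.barred a) (.unbarred b) ∧
    ∀ x y : Letter N, ¬ (x = .unbarred b ∧ y = .barred a) → ¬ (x = .barred a ∧ y = .unbarred b) →
      (o.lt x y ↔ o'.lt x y)

/-- Two boxes share an edge. -/
def BoxAdj (c c' : ℕ × ℕ) : Prop :=
  (c.1 = c'.1 ∧ (c.2 + 1 = c'.2 ∨ c'.2 + 1 = c.2)) ∨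
    (c.2 = c'.2 ∧ (c.1 + 1 = c'.1 ∨ c'.1 + 1 = c.1))

/-- The set of boxes of `T` filled with `b` or `ā`. -/
def ribbon {N : ℕ} {ν : YoungDiagram} (T : Filling N ν) (b a : Fin N) : Set ν :=
  {c | T c = .unbarred b ∨ T c = .barred a}

/-- The connected component of the box `c` in a set `R` of boxes. -/
def component {ν : YoungDiagram} (R : Set ν) (c : ν) : Set ν :=
  {c' | Relation.ReflTransGen (fun d d' : ν => d ∈ R ∧ d' ∈ R ∧ BoxAdj d.1 d'.1) c c'}

/-- `T'` arises from `T` by refilling each connected component of the set of boxes containing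
`b` or `ā` with the same number of letters `b` and the same number of letters `ā`. -/
def Refills {N : ℕ} {ν : YoungDiagram} (b a : Fin N) (T T' : Filling N ν) : Prop :=
  (∀ c, c ∉ ribbon T b a → T' c = T c) ∧
  ∀ c, c ∈ ribbon T b a →
    {d ∈ component (ribbon T b a) c | T' d = .unbarred b}.ncard =
      {d ∈ component (ribbon T b a) c | T d = .unbarred b}.ncard ∧
    {d ∈ component (ribbon T b a) c | T' d = .barred a}.ncard =
      {d ∈ component (ribbon T b a) c | T d = .barred a}.ncard

/-- A single step of conversion: from an `o`-colored tableau to an `o'`-colored tableau, where the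
orders `o` and `o'` differ by swapping one unbarred letter with one barred letter
(in either direction). -/
def ConvertStep {N : ℕ} {ν : YoungDiagram} (p q : ShuffleOrder N × Filling N ν) : Prop :=
  ∃ b a : Fin N, (DifferBySwap p.1 q.1 b a ∨ DifferBySwap q.1 p.1 b a) ∧
    IsColored p.1 p.2 ∧ IsColored q.1 q.2 ∧ Refills b a p.2 q.2

/-- `ConvertsTo o o' T T'`: the filling `T'` is obtained from `T` by conversion along some sequence
of swaps of consecutive letters leading from the order `o` to the order `o'`. -/
def ConvertsTo {N : ℕ} {ν : YoungDiagram} (o o' : ShuffleOrder N) (T T' : Filling N ν) : Prop :=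
  Relation.ReflTransGen ConvertStep (o, T) (o', T')

end ColoredTableaux

/-! ### Local plactic relations in a monoid -/

namespace ColoredTableaux

/-! Membership in `W` depends only on the class of a word in the syntactic monoid of `W`.
Orthogonality to the ideal turns its binomial relations into identities of letter classes, and
shuffle closure makes barred classes commute with unbarred ones. Hence the class of a word is the
product of its unbarred part and its barred part. The unbarred classes satisfy the local plactic
relations, the barred ones the same relations in the opposite monoid. It suffices that conversion
preserves each of the two products over `sqread`.

The boxes with `b` or `ā` form ribbons, whose letters are all forced except at one end of each
component. So a single refilling exists, is unique, and is a rotation along the ribbon. Swaps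
available at the same order involve disjoint pairs of letters and commute, so conversion is
independent of the path (`downSteps_unique`, `convertsTo_unique`). This gives well-definedness and,
just as important, the freedom to choose one path for the unbarred part and another for the barred
part.

For the unbarred part, barred letters are moved down one after another, so that no other barred
letter is close to `b` when `b` and `ā` are swapped (`exists_swap_before`). In such a swap the net
effect on the rows is that single letters `b` pass from a row to the next one below
(`exists_transfer`). The absence of nearby barred letters bounds the number of letters `b - 1` and
`b + 1` in these rows by the number of `b`'s, which is exactly what the local plactic relations need
to move a `b` (`LocalPlactic.transfer`). Thus the row reading word is invariant
(`descProd_rowList_eq`). For the two extreme orders `sqread` is equivalent to the row reading word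
(`prod_sqread_eq_descProd`), because at most one barred letter lies between consecutive unbarred
letters.

The barred part follows by transposing and exchanging the two kinds of letters, which reverses both
the reading word and the direction of swaps. Surjectivity holds since every swap can be undone. -/

/-- The defining relations of the local plactic monoid, for the images `g 0, g 1, …` of its
generators in a monoid. -/
structure LocalPlactic {M : Type*} [Monoid M] (g : ℕ → M) : Prop where
  comm : ∀ x z, x + 2 ≤ z → g x * g z = g z * g x
  yyx : ∀ x, g (x + 1) * g (x + 1) * g x = g (x + 1) * g x * g (x + 1)
  zyy : ∀ y, g (y + 1) * g y * g y = g y * g (y + 1) * g y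

section Monoid
variable {M : Type*} [Monoid M]

/-- The induction hypothesis, read backwards, brings one `y` up to the last `x`, where `yxy = yyx`
applies; then both `y`'s travel back. Each `x` uses up one `y` on its left, hence `p ≤ k`. -/
theorem pow_mul_pow_mul_of_yyx {x y : M} (h : y * y * x = y * x * y) :
    ∀ p k : ℕ, p ≤ k → y ^ k * x ^ p * y = y ^ (k + 1) * x ^ p := by
  intro p
  induction p with
  | zero => intro k _; simp [pow_succ]
  | succ p ih =>
    intro k hk
    obtain ⟨k, rfl⟩ : ∃ l, k = l + 1 := ⟨k - 1, by omega⟩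
    calc y ^ (k + 1) * x ^ (p + 1) * y = (y ^ (k + 1) * x ^ p) * x * y := by
          rw [pow_succ x]; simp only [mul_assoc]
      _ = y ^ k * x ^ p * (y * x * y) := by rw [← ih k (by omega)]; simp only [mul_assoc]
      _ = (y ^ k * x ^ p * y) * y * x := by rw [← h]; simp only [mul_assoc]
      _ = y ^ (k + 1 + 1) * x ^ (p + 1) := by
          rw [ih k (by omega), ih (k + 1) (by omega), pow_succ x, mul_assoc]

/-- A `y` crosses a `z` only while a further `y` stands behind it, so each `z` needs its own `y`,
hence `s ≤ n`. -/
theorem pow_mul_pow_of_zyy {y z : M} (h : z * y * y = y * z * y) :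
    ∀ s n : ℕ, s ≤ n → z ^ s * y ^ (n + 1) = y * z ^ s * y ^ n := by
  intro s
  induction s with
  | zero => intro n _; simp [pow_succ']
  | succ s ih =>
    intro n hn
    obtain ⟨n, rfl⟩ : ∃ l, n = l + 1 := ⟨n - 1, by omega⟩
    calc z ^ (s + 1) * y ^ (n + 1 + 1) = z * (z ^ s * y ^ (n + 1 + 1)) := by
          rw [pow_succ' z, mul_assoc]
      _ = z * y * (z ^ s * y ^ (n + 1)) := by rw [ih _ (by omega)]; simp only [mul_assoc]
      _ = z * y * y * (z ^ s * y ^ n) := by rw [ih _ (by omega)]; simp only [mul_assoc]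
      _ = y * z * (y * z ^ s * y ^ n) := by rw [h]; simp only [mul_assoc]
      _ = y * z ^ (s + 1) * y ^ (n + 1) := by
          rw [← ih n (by omega), pow_succ' z]; simp only [mul_assoc]

/-- Collecting the second factors of a product of products on the right. -/
theorem prod_mul_eq_prod_mul_prod (E f : ℕ → M) (L : ℕ)
    (h : ∀ d k, d < k → k < L → f d * E k * f (d + 1) = E k * f d * f (d + 1)) :
    ((List.range L).map fun k => E k * f k).prod =
      ((List.range L).map E).prod * ((List.range L).map f).prod := by
  induction L with
  | zero => simp
  | succ L ih =>
    -- The new block `E L` crosses the collected factors from right to left. Each crossing is paid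
    -- for by the next factor `f` on its right, so `f m` has to stay in the statement; at `m = L` it
    -- is the factor just read.
    have key : ∀ m ≤ L, ((List.range m).map f).prod * E L * f m =
        E L * ((List.range m).map f).prod * f m := by
      intro m
      induction m with
      | zero => simp
      | succ m ihm =>
        intro hm
        rw [List.range_succ, List.map_append, List.prod_append]
        simp only [List.map_cons, List.map_nil, List.prod_cons, List.prod_nil, mul_one]
        calc (List.map f (List.range m)).prod * f m * E L * f (m + 1)
            = (List.map f (List.range m)).prod * (f m * E L * f (m + 1)) := by
              simp only [mul_assoc]
          _ = ((List.map f (List.range m)).prod * E L * f m) * f (m + 1) := by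
              rw [h m L (by omega) (by omega)]; simp only [mul_assoc]
          _ = _ := by rw [ihm (by omega)]; simp only [mul_assoc]
    rw [List.range_succ]
    simp only [List.map_append, List.prod_append, List.map_cons, List.map_nil, List.prod_cons,
      List.prod_nil, mul_one]
    rw [ih fun d k hd hk => h d k hd (by omega)]
    have := key L le_rfl
    simp only [mul_assoc] at this ⊢
    rw [this]

theorem sorted_eq_append {l : List ℕ} (hl : l.Pairwise (· ≤ ·)) (b : ℕ) :
    l = l.filter (· < b) ++ (List.replicate (l.count b) b ++ l.filter (b < ·)) := by
  induction l with
  | nil => simp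
  | cons x l ih =>
    rw [List.pairwise_cons] at hl
    have ih := ih hl.2
    rcases lt_trichotomy x b with h | h | h
    · have h1 : ¬ b < x := by omega
      have h2 : x ≠ b := by omega
      simp only [List.filter_cons, h, h1, decide_true, decide_false, if_true,
        List.count_cons_of_ne h2, List.cons_append, Bool.false_eq_true, if_false]
      exact congrArg _ ih
    · subst h
      have h0 : l.filter (· < x) = [] := by
        rw [List.filter_eq_nil_iff]; intro a ha; have := hl.1 a ha; simpa using this
      rw [h0] at ih
      simp only [List.filter_cons, lt_irrefl, decide_false, List.count_cons_self, h0,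
        List.replicate_succ, List.cons_append]
      simpa using ih
    · have h0 : ∀ c, c ≤ b → l.count c = 0 := by
        intro c hc; rw [List.count_eq_zero]; intro hm; have := hl.1 c hm; omega
      have h1 : l.filter (· < b) = [] := by
        rw [List.filter_eq_nil_iff]; intro a ha; have := hl.1 a ha; simp; omega
      have h2 : l.filter (b < ·) = l := by
        rw [List.filter_eq_self]; intro a ha; have := hl.1 a ha; simp; omega
      have h3 : ¬ x < b := by omega
      have h4 : x ≠ b := by omega
      simp [h, h3, h1, h2, h0 b le_rfl, List.count_cons_of_ne h4]

theorem commute_prod {l : List M} {y : M} (h : ∀ x ∈ l, Commute x y) : Commute l.prod y := by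
  induction l with
  | nil => simp
  | cons a l ih =>
    rw [List.prod_cons]
    exact (h a (by simp)).mul_left (ih fun x hx => h x (by simp [hx]))

theorem LocalPlactic.commute {g : ℕ → M} (hg : LocalPlactic g) {x z : ℕ} (h : x + 2 ≤ z ∨ z + 2 ≤ x) : Commute (g x) (g z) := by
  rcases h with h | h
  · exact hg.comm x z h
  · exact (hg.comm z x h).symm

/-- All letters of the list below `b - 1` commute with `b`, so only the final block of letters `b -
1` matters. For `b = 0` the list is empty. -/
theorem LocalPlactic.pow_mul_low {g : ℕ → M} (hg : LocalPlactic g) {b : ℕ} {l : List ℕ} (hl : l.Pairwise (· ≤ ·))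
    (hb : ∀ x ∈ l, x < b) {k : ℕ} (hk : l.count (b - 1) ≤ k) :
    g b ^ k * (l.map g).prod * g b = g b ^ (k + 1) * (l.map g).prod := by
  rcases Nat.eq_zero_or_pos b with h0 | h0
  · have : l = [] := by
      rw [List.eq_nil_iff_forall_not_mem]; intro x hx; have := hb x hx; omega
    subst this; simp [pow_succ]
  obtain ⟨a, rfl⟩ : ∃ a, b = a + 1 := ⟨b - 1, by omega⟩
  simp only [Nat.add_sub_cancel] at hk
  have hs := sorted_eq_append hl a
  have h1 : l.filter (a < ·) = [] := by
    rw [List.filter_eq_nil_iff]; intro x hx; have := hb x hx; simp; omega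
  rw [h1, List.append_nil] at hs
  have hp : (l.map g).prod = ((l.filter (· < a)).map g).prod * g a ^ l.count a := by
    conv_lhs => rw [hs]
    simp
  have hc : Commute ((l.filter (· < a)).map g).prod (g (a + 1)) := by
    apply commute_prod
    intro x hx
    simp only [List.mem_map, List.mem_filter, decide_eq_true_eq] at hx
    obtain ⟨y, ⟨_, hy⟩, rfl⟩ := hx
    exact hg.commute (by omega)
  rw [hp]
  have h2 := pow_mul_pow_mul_of_yyx (hg.yyx a) _ _ hk
  calc _ = (g (a + 1) ^ k * ((l.filter (· < a)).map g).prod) * g a ^ l.count a * g (a + 1) := by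
        simp only [mul_assoc]
    _ = ((l.filter (· < a)).map g).prod * (g (a + 1) ^ k * g a ^ l.count a * g (a + 1)) := by
        rw [← (hc.pow_right k).eq]; simp only [mul_assoc]
    _ = (((l.filter (· < a)).map g).prod * g (a + 1) ^ (k + 1)) * g a ^ l.count a := by
        rw [h2]; simp only [mul_assoc]
    _ = _ := by rw [(hc.pow_right (k + 1)).eq, mul_assoc]

theorem LocalPlactic.high_mul_pow {g : ℕ → M} (hg : LocalPlactic g) {b : ℕ} {l : List ℕ} (hl : l.Pairwise (· ≤ ·))
    (hb : ∀ x ∈ l, b < x) {n : ℕ} (hn : l.count (b + 1) ≤ n) :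
    (l.map g).prod * g b ^ (n + 1) = g b * (l.map g).prod * g b ^ n := by
  have hs := sorted_eq_append hl (b + 1)
  have h1 : l.filter (· < b + 1) = [] := by
    rw [List.filter_eq_nil_iff]; intro x hx; have := hb x hx; simp; omega
  rw [h1, List.nil_append] at hs
  have hp : (l.map g).prod =
      g (b + 1) ^ l.count (b + 1) * ((l.filter (b + 1 < ·)).map g).prod := by
    conv_lhs => rw [hs]
    simp
  have hc : Commute ((l.filter (b + 1 < ·)).map g).prod (g b) := by
    apply commute_prod
    intro x hx
    simp only [List.mem_map, List.mem_filter, decide_eq_true_eq] at hx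
    obtain ⟨y, ⟨_, hy⟩, rfl⟩ := hx
    exact hg.commute (by omega)
  rw [hp]
  have h2 := pow_mul_pow_of_zyy (hg.zyy b) _ _ hn
  rw [mul_assoc, (hc.pow_right (n + 1)).eq, ← mul_assoc, h2]
  simp only [mul_assoc]
  rw [(hc.pow_right n).eq]

/-- Moving a letter `b` from the first row to the second one. -/
theorem LocalPlactic.transfer {g : ℕ → M} (hg : LocalPlactic g) {b : ℕ} {lo hi : List ℕ} (hlo : lo.Pairwise (· ≤ ·))
    (hhi : hi.Pairwise (· ≤ ·)) (hlo' : ∀ x ∈ lo, x < b) (hhi' : ∀ x ∈ hi, b < x) {k n : ℕ}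
    (hk : lo.count (b - 1) ≤ k) (hn : hi.count (b + 1) ≤ n) :
    g b ^ k * (hi.map g).prod * (lo.map g).prod * g b ^ (n + 1) =
      g b ^ (k + 1) * (hi.map g).prod * (lo.map g).prod * g b ^ n := by
  have hc : Commute (hi.map g).prod (lo.map g).prod := by
    apply commute_prod
    intro x hx
    refine (commute_prod ?_).symm
    intro y hy
    simp only [List.mem_map] at hx hy
    obtain ⟨x, hx, rfl⟩ := hx
    obtain ⟨y, hy, rfl⟩ := hy
    have := hlo' y hy
    have := hhi' x hx
    exact hg.commute (by omega)
  have h1 := hg.pow_mul_low hlo hlo' hk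
  have h2 := hg.high_mul_pow hhi hhi' hn
  rw [mul_assoc _ (hi.map g).prod, mul_assoc _ (hi.map g).prod, hc.eq]
  calc _ = g b ^ k * (lo.map g).prod * ((hi.map g).prod * g b ^ (n + 1)) := by
        simp only [mul_assoc]
    _ = (g b ^ k * (lo.map g).prod * g b) * ((hi.map g).prod * g b ^ n) := by
        rw [h2]; simp only [mul_assoc]
    _ = _ := by rw [h1]; simp only [mul_assoc]

end Monoid
end ColoredTableaux

/-! ### Shuffle orders and sequences of swaps -/

namespace ColoredTableaux
open Relation

instance {N : ℕ} : Finite (Letter N) :=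
  Finite.of_injective (β := Fin N ⊕ Fin N)
    (fun | .unbarred a => Sum.inl a | .barred a => Sum.inr a)
    (by rintro (a | a) (b | b) h <;> simp_all)

namespace ShuffleOrder
variable {N : ℕ}

theorem irrefl (o : ShuffleOrder N) (x : Letter N) : ¬ o.lt x x := o.total.irrefl x

theorem trans (o : ShuffleOrder N) {x y z : Letter N} (h : o.lt x y) (h' : o.lt y z) : o.lt x z :=
  o.total.trans _ _ _ h h'

theorem asymm (o : ShuffleOrder N) {x y : Letter N} (h : o.lt x y) : ¬ o.lt y x :=
  fun h' => o.irrefl _ (o.trans h h')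

theorem lt_or_lt (o : ShuffleOrder N) {x y : Letter N} (h : x ≠ y) : o.lt x y ∨ o.lt y x := by
  by_contra hn
  rw [not_or] at hn
  exact h (o.total.trichotomous _ _ hn.1 hn.2)

/-- The number of letters below a given one. -/
noncomputable def rank (o : ShuffleOrder N) (x : Letter N) : ℕ := {y | o.lt y x}.ncard

theorem rank_lt (o : ShuffleOrder N) {x y : Letter N} (h : o.lt x y) : o.rank x < o.rank y := by
  apply Set.ncard_lt_ncard _ (Set.toFinite _)
  refine ⟨fun z hz => o.trans hz h, fun hs => o.irrefl x (hs h)⟩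

theorem lt_iff (o : ShuffleOrder N) {x y : Letter N} : o.lt x y ↔ o.rank x < o.rank y := by
  refine ⟨o.rank_lt, fun h => ?_⟩
  have hne : x ≠ y := by rintro rfl; exact lt_irrefl _ h
  rcases o.lt_or_lt hne with h' | h'
  · exact h'
  · have := o.rank_lt h'; omega

theorem rank_injective (o : ShuffleOrder N) : Function.Injective o.rank := by
  intro x y h
  by_contra hne
  rcases o.lt_or_lt hne with h' | h' <;> have := o.rank_lt h' <;> omega

theorem rank_eq (o : ShuffleOrder N) {x y : Letter N} : o.rank x = o.rank y ↔ x = y :=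
  o.rank_injective.eq_iff

theorem rank_ne (o : ShuffleOrder N) {x y : Letter N} (h : x ≠ y) : o.rank x ≠ o.rank y :=
  o.rank_injective.ne h

theorem unbarred_lt_iff (o : ShuffleOrder N) {a b : Fin N} :
    o.lt (.unbarred a) (.unbarred b) ↔ a < b := by
  refine ⟨fun h => ?_, o.unbarred_lt a b⟩
  by_contra hn
  rcases (not_lt.mp hn).lt_or_eq with h' | h'
  · exact o.asymm h (o.unbarred_lt _ _ h')
  · subst h'; exact o.irrefl _ h

theorem barred_lt_iff (o : ShuffleOrder N) {a b : Fin N} :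
    o.lt (.barred a) (.barred b) ↔ a < b := by
  refine ⟨fun h => ?_, o.barred_lt a b⟩
  by_contra hn
  rcases (not_lt.mp hn).lt_or_eq with h' | h'
  · exact o.asymm h (o.barred_lt _ _ h')
  · subst h'; exact o.irrefl _ h

/-- A shuffle order is determined by the comparisons of unbarred with barred letters. -/
theorem ext_of_mixed {o o' : ShuffleOrder N}
    (h : ∀ b a, o.lt (.unbarred b) (.barred a) ↔ o'.lt (.unbarred b) (.barred a)) : o = o' := by
  have h' : ∀ b a, o.lt (.barred a) (.unbarred b) ↔ o'.lt (.barred a) (.unbarred b) := by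
    intro b a
    have h1 := o.lt_iff (x := .unbarred b) (y := .barred a)
    have h2 := o'.lt_iff (x := .unbarred b) (y := .barred a)
    have h3 := o.rank_eq (x := .unbarred b) (y := .barred a)
    have h4 := o'.rank_eq (x := .unbarred b) (y := .barred a)
    simp only [reduceCtorEq, iff_false] at h3 h4
    have := h b a
    rw [o.lt_iff, o'.lt_iff] at *
    omega
  apply ShuffleOrder.ext
  funext x y
  apply propext
  rcases x with x | x <;> rcases y with y | y
  · rw [o.unbarred_lt_iff, o'.unbarred_lt_iff]
  · exact h _ _
  · exact h' _ _
  · rw [o.barred_lt_iff, o'.barred_lt_iff]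

/-- Two adjacent letters of different kinds can be swapped. -/
theorem exists_swap (o : ShuffleOrder N) {x y : Letter N} (hxy : x.isBarred ≠ y.isBarred)
    (hlt : o.lt x y) (hadj : ∀ z, o.lt x z → ¬ o.lt z y) :
    ∃ o' : ShuffleOrder N, o'.lt y x ∧
      ∀ u v, ¬ (u = x ∧ v = y) → ¬ (u = y ∧ v = x) → (o.lt u v ↔ o'.lt u v) := by
  have hne : x ≠ y := by rintro rfl; exact hxy rfl
  have hx : ∀ z, z ≠ x → z ≠ y → (o.rank z < o.rank x ↔ o.rank z < o.rank y) := by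
    intro z h1 h2
    have h3 := hadj z
    rw [o.lt_iff] at hlt h3
    rw [o.lt_iff] at h3
    have := o.rank_ne h1
    have := o.rank_ne h2
    omega
  -- As nothing lies between `x` and `y`, every other letter compares in the same way with both. So
  -- the order pulled back along their transposition differs from the old one only on this pair.
  have key : ∀ u v, ¬ (u = x ∧ v = y) → ¬ (u = y ∧ v = x) →
      (o.lt u v ↔ o.lt (Equiv.swap x y u) (Equiv.swap x y v)) := by
    intro u v h1 h2
    simp only [o.lt_iff]
    rw [o.lt_iff] at hlt
    have hxu := hx u
    have hxv := hx v
    by_cases hux : u = x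
    · subst hux
      by_cases hvx : v = u
      · subst hvx; simp
      · have hvy : v ≠ y := fun h => h1 ⟨rfl, h⟩
        rw [Equiv.swap_apply_left, Equiv.swap_apply_of_ne_of_ne hvx hvy]
        have := hxv hvx hvy
        have := o.rank_ne hvx
        have := o.rank_ne hvy
        omega
    by_cases huy : u = y
    · subst huy
      by_cases hvy : v = u
      · subst hvy; simp
      · have hvx : v ≠ x := fun h => h2 ⟨rfl, h⟩
        rw [Equiv.swap_apply_right, Equiv.swap_apply_of_ne_of_ne hvx hvy]
        have := hxv hvx hvy
        have := o.rank_ne hvx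
        have := o.rank_ne hvy
        omega
    rw [Equiv.swap_apply_of_ne_of_ne hux huy]
    by_cases hvx : v = x
    · subst hvx
      rw [Equiv.swap_apply_left]
      exact hxu hux huy
    by_cases hvy : v = y
    · subst hvy
      rw [Equiv.swap_apply_right]
      exact (hxu hux huy).symm
    rw [Equiv.swap_apply_of_ne_of_ne hvx hvy]
  refine ⟨⟨fun u v => o.lt (Equiv.swap x y u) (Equiv.swap x y v), ?_, ?_, ?_⟩, ?_, key⟩
  · exact
      { trichotomous := fun u v h h' =>
          (Equiv.swap x y).injective (o.total.trichotomous _ _ h h')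
        irrefl := fun u => o.irrefl _
        trans := fun _ _ _ h h' => o.trans h h' }
  · intro a b hab
    rw [← key]
    · exact o.unbarred_lt a b hab
    · rintro ⟨rfl, rfl⟩; exact hxy rfl
    · rintro ⟨rfl, rfl⟩; exact hxy rfl
  · intro a b hab
    rw [← key]
    · exact o.barred_lt a b hab
    · rintro ⟨rfl, rfl⟩; exact hxy rfl
    · rintro ⟨rfl, rfl⟩; exact hxy rfl
  · simpa using hlt

end ShuffleOrder

variable {N : ℕ} {o o' o₁ o₂ : ShuffleOrder N} {a b a' b' : Fin N}

/-- The letters `b` and `ā` are on the same side of every other letter. -/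
def SameSide (o : ShuffleOrder N) (b a : Fin N) : Prop :=
  ∀ z : Letter N, z ≠ .unbarred b → z ≠ .barred a →
    (o.lt z (.unbarred b) ↔ o.lt z (.barred a))

theorem DifferBySwap.sameSide_left (h : DifferBySwap o o' b a) : SameSide o b a := by
  intro z h1 h2
  obtain ⟨hl, hl', hiff⟩ := h
  have e1 := hiff z (.unbarred b) (by simp) (by simp [h2])
  have e2 := hiff z (.barred a) (by simp [h1]) (by simp)
  have e3 := hiff (.barred a) z (by simp) (by simp [h1])
  have := o.rank_ne h1
  have := o.rank_ne h2
  have := o'.rank_ne h1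
  have := o'.rank_ne h2
  simp only [o.lt_iff, o'.lt_iff] at *
  omega

theorem DifferBySwap.sameSide_right (h : DifferBySwap o o' b a) : SameSide o' b a := by
  intro z h1 h2
  have := h.sameSide_left z h1 h2
  rwa [h.2.2 _ _ (by simp) (by simp [h2]), h.2.2 _ _ (by simp [h1]) (by simp)] at this

theorem exists_differBySwap (hlt : o.lt (.unbarred b) (.barred a))
    (hadj : ∀ z, o.lt (.unbarred b) z → ¬ o.lt z (.barred a)) :
    ∃ o', DifferBySwap o o' b a := by
  obtain ⟨o', h1, h2⟩ := o.exists_swap (by simp [Letter.isBarred]) hlt hadj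
  exact ⟨o', hlt, h1, h2⟩

theorem exists_differBySwap_symm (hlt : o'.lt (.barred a) (.unbarred b))
    (hadj : ∀ z, o'.lt (.barred a) z → ¬ o'.lt z (.unbarred b)) :
    ∃ o, DifferBySwap o o' b a := by
  obtain ⟨o, h1, h2⟩ := o'.exists_swap (by simp [Letter.isBarred]) hlt hadj
  exact ⟨o, h1, hlt, fun x y h h' => (h2 x y h' h).symm⟩

theorem DifferBySwap.right_unique (h : DifferBySwap o o₁ b a) (h' : DifferBySwap o o₂ b a) :
    o₁ = o₂ := by
  apply ShuffleOrder.ext_of_mixed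
  intro d c
  by_cases hp : d = b ∧ c = a
  · obtain ⟨rfl, rfl⟩ := hp
    exact iff_of_false (o₁.asymm h.2.1) (o₂.asymm h'.2.1)
  · rw [← h.2.2 _ _ (by simpa using hp) (by simp), ← h'.2.2 _ _ (by simpa using hp) (by simp)]

/-- Both pairs are consecutive for `o`, and a letter has only one successor and one predecessor.
Disjointness of the pairs is what makes the two ribbons disjoint. -/
theorem DifferBySwap.ne_of_ne (h : DifferBySwap o o₁ b a) (h' : DifferBySwap o o₂ b' a')
    (hne : ¬ (b = b' ∧ a = a')) : b ≠ b' ∧ a ≠ a' := by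
  have s := h.sameSide_left
  have s' := h'.sameSide_left
  have l := h.1
  have l' := h'.1
  constructor
  · rintro rfl
    have haa : a ≠ a' := fun h => hne ⟨rfl, h⟩
    have e1 := s (.barred a') (by simp) (by simpa using haa.symm)
    have e2 := s' (.barred a) (by simp) (by simpa using haa)
    have := o.rank_ne (show Letter.barred a ≠ .barred a' by simpa using haa)
    simp only [o.lt_iff] at *
    omega
  · rintro rfl
    have haa : b ≠ b' := fun h => hne ⟨h, rfl⟩
    have e1 := s (.unbarred b') (by simpa using haa.symm) (by simp)
    have e2 := s' (.unbarred b) (by simpa using haa) (by simp)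
    have := o.rank_ne (show Letter.unbarred b ≠ .unbarred b' by simpa using haa)
    simp only [o.lt_iff] at *
    omega

/-- Swaps of different pairs of letters commute. -/
theorem DifferBySwap.diamond (h : DifferBySwap o o₁ b a) (h' : DifferBySwap o o₂ b' a')
    (hne : ¬ (b = b' ∧ a = a')) :
    ∃ o₃, DifferBySwap o₁ o₃ b' a' ∧ DifferBySwap o₂ o₃ b a := by
  obtain ⟨hb, ha⟩ := h.ne_of_ne h' hne
  have e : ∀ u v : Letter N, u = .unbarred b' ∨ v = .barred a' → (o.lt u v ↔ o₁.lt u v) := by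
    rintro u v (rfl | rfl) <;> apply h.2.2 <;> simp [hb.symm, ha.symm]
  obtain ⟨o₃, h₃⟩ := exists_differBySwap (o := o₁) (b := b') (a := a')
    ((e _ _ (Or.inl rfl)).mp h'.1) (by
      intro z h1 h2
      rw [← e _ _ (Or.inl rfl)] at h1
      rw [← e _ _ (Or.inr rfl)] at h2
      have hz1 : z ≠ .unbarred b' := by rintro rfl; exact o.irrefl _ h1
      have hz2 : z ≠ .barred a' := by rintro rfl; exact o.irrefl _ h2
      exact o.asymm h1 ((h'.sameSide_left z hz1 hz2).mpr h2))
  refine ⟨o₃, h₃, ?_, ?_, ?_⟩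
  · rw [← h'.2.2 _ _ (by simp [hb]) (by simp)]; exact h.1
  · rw [← h₃.2.2 _ _ (by simp) (by simp [hb])]; exact h.2.1
  · intro x y h1 h2
    by_cases h3 : x = .unbarred b' ∧ y = .barred a'
    · obtain ⟨rfl, rfl⟩ := h3
      exact iff_of_false (o₂.asymm h'.2.1) (o₃.asymm h₃.2.1)
    by_cases h4 : x = .barred a' ∧ y = .unbarred b'
    · obtain ⟨rfl, rfl⟩ := h4
      exact iff_of_true h'.2.1 h₃.2.1
    rw [← h'.2.2 _ _ h3 h4, h.2.2 _ _ h1 h2, h₃.2.2 _ _ h3 h4]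

/-! ### Sequences of swaps starting at the big bar order -/

theorem bigBarOrder_lt (b a : Fin N) : (bigBarOrder N).lt (.unbarred b) (.barred a) := by
  have := b.isLt
  simp only [bigBarOrder, bigBarRank]
  omega

/-- The number of pairs `ā ⋖ b`. -/
noncomputable def inversions (o : ShuffleOrder N) : ℕ :=
  {p : Fin N × Fin N | o.lt (.barred p.2) (.unbarred p.1)}.ncard

theorem DifferBySwap.inversions_lt (h : DifferBySwap o o' b a) : inversions o < inversions o' := by
  apply Set.ncard_lt_ncard _ (Set.toFinite _)
  constructor
  · rintro ⟨d, c⟩ hdc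
    simp only [Set.mem_ofPred_eq] at hdc ⊢
    by_cases hp : c = a ∧ d = b
    · obtain ⟨rfl, rfl⟩ := hp; exact h.2.1
    · exact (h.2.2 _ _ (by simp) (by simpa using hp)).mp hdc
  · intro hs
    exact o.asymm h.1 (hs (a := (b, a)) h.2.1)

/-- Every gap between consecutive unbarred letters contains at most one barred letter. -/
def SparseBarred (o : ShuffleOrder N) : Prop :=
  ∀ x z c c' : Fin N, x.val + 1 = z.val →
    o.lt (.unbarred x) (.barred c) → o.lt (.barred c) (.unbarred z) →
    o.lt (.unbarred x) (.barred c') → o.lt (.barred c') (.unbarred z) → c = c'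

/-- Every gap between consecutive barred letters contains at most one unbarred letter. -/
def SparseUnbarred (o : ShuffleOrder N) : Prop :=
  ∀ x z c c' : Fin N, x.val + 1 = z.val →
    o.lt (.barred x) (.unbarred c) → o.lt (.unbarred c) (.barred z) →
    o.lt (.barred x) (.unbarred c') → o.lt (.unbarred c') (.barred z) → c = c'

/-- No barred letter is strictly between `b - 1` and `b` for `o`, or strictly between `b` and
`b + 1` for `o'`. -/
structure ClearAround (o o' : ShuffleOrder N) (b : Fin N) : Prop where
  below : ∀ x c : Fin N, x.val + 1 = b.val →
    o.lt (.unbarred x) (.barred c) → ¬ o.lt (.barred c) (.unbarred b)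
  above : ∀ z c : Fin N, b.val + 1 = z.val →
    o'.lt (.unbarred b) (.barred c) → ¬ o'.lt (.barred c) (.unbarred z)

/-- No unbarred letter is strictly between `ā - 1` and `ā` for `o'`, or strictly between `ā` and
the next barred letter for `o`. -/
structure ClearAroundBarred (o o' : ShuffleOrder N) (a : Fin N) : Prop where
  below : ∀ x c : Fin N, x.val + 1 = a.val →
    o'.lt (.barred x) (.unbarred c) → ¬ o'.lt (.unbarred c) (.barred a)
  above : ∀ z c : Fin N, a.val + 1 = z.val →
    o.lt (.barred a) (.unbarred c) → ¬ o.lt (.unbarred c) (.barred z)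

theorem sparseBarred_natOrder : SparseBarred (natOrder N) := by
  intro x z c c' h h1 h2 h3 h4
  simp only [natOrder, natRank] at *
  exact Fin.ext (by omega)

theorem sparseUnbarred_natOrder : SparseUnbarred (natOrder N) := by
  intro x z c c' h h1 h2 h3 h4
  simp only [natOrder, natRank] at *
  exact Fin.ext (by omega)

theorem sparseBarred_bigBarOrder : SparseBarred (bigBarOrder N) := by
  intro x z c c' h h1 h2 h3 h4
  simp only [bigBarOrder, bigBarRank] at *
  exact Fin.ext (by omega)

theorem sparseUnbarred_bigBarOrder : SparseUnbarred (bigBarOrder N) := by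
  intro x z c c' h h1 h2 h3 h4
  simp only [bigBarOrder, bigBarRank] at *
  exact Fin.ext (by omega)

theorem eq_bigBarOrder (h : ∀ b a, ¬ o.lt (.barred a) (.unbarred b)) : o = bigBarOrder N :=
  ShuffleOrder.ext_of_mixed fun b a =>
    iff_of_true ((o.lt_or_lt (by simp)).resolve_right (h b a)) (bigBarOrder_lt b a)

theorem exists_max_fin {p : Fin N → Prop} (h : ∃ a, p a) : ∃ a, p a ∧ ∀ c, p c → c ≤ a := by
  obtain ⟨m, hm⟩ := (Set.toFinite {a | p a}).exists_maximal h
  exact ⟨m, hm.1, fun c hc => not_lt.mp fun hlt => hm.not_gt hc hlt⟩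

theorem exists_min_fin {p : Fin N → Prop} (h : ∃ a, p a) : ∃ a, p a ∧ ∀ c, p c → a ≤ c := by
  obtain ⟨m, hm⟩ := (Set.toFinite {a | p a}).exists_minimal h
  exact ⟨m, hm.1, fun c hc => not_lt.mp fun hlt => hm.not_lt hc hlt⟩

/-- Take `ā` as the largest barred letter below some unbarred letter and `b` as the least unbarred
letter above `ā`; then `b` directly follows `ā`. If `o'` is sparse, `ā` is the only barred letter
between `b - 1` and `b`, so undoing the swap empties this gap. The gap above `b` is empty for `o'`,
since barred letters above `ā` exceed all unbarred ones. -/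
theorem exists_swap_before (hne : o' ≠ bigBarOrder N) :
    ∃ o b a, DifferBySwap o o' b a ∧
      (SparseBarred o' → SparseBarred o ∧ ClearAround o o' b) := by
  have h0 : ∃ a b, o'.lt (.barred a) (.unbarred b) := by
    by_contra hn
    push Not at hn
    exact hne (eq_bigBarOrder fun b a => hn a b)
  obtain ⟨a, ha, hmax⟩ := exists_max_fin h0
  obtain ⟨b, hb, hmin⟩ := exists_min_fin ha
  have hmax' : ∀ c d, a < c → o'.lt (.unbarred d) (.barred c) := fun c d hc =>
    (o'.lt_or_lt (by simp)).resolve_right fun hl => absurd (hmax c ⟨d, hl⟩) (not_le.mpr hc)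
  have hmin' : ∀ d, d < b → o'.lt (.unbarred d) (.barred a) := fun d hd =>
    (o'.lt_or_lt (by simp)).resolve_right fun hl => absurd (hmin d hl) (not_le.mpr hd)
  obtain ⟨o, ho⟩ := exists_differBySwap_symm (o' := o') hb (by
    rintro (z | z) h1 h2
    · exact o'.asymm h1 (hmin' z (o'.unbarred_lt_iff.mp h2))
    · exact o'.asymm h2 (hmax' z b (o'.barred_lt_iff.mp h1)))
  refine ⟨o, b, a, ho, fun hs => ?_⟩
  have e1 : ∀ d c, ¬ (d = b ∧ c = a) → (o.lt (.unbarred d) (.barred c) ↔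
      o'.lt (.unbarred d) (.barred c)) := fun d c h =>
    ho.2.2 _ _ (by simpa using h) (by simp)
  have e2 : ∀ d c, ¬ (c = a ∧ d = b) → (o.lt (.barred c) (.unbarred d) ↔
      o'.lt (.barred c) (.unbarred d)) := fun d c h =>
    ho.2.2 _ _ (by simp) (by simpa using h)
  have hclear : ClearAround o o' b := by
    constructor
    · intro x c hx h1 h2
      have hxb : x < b := Fin.lt_def.mpr (by omega)
      rw [e1 _ _ (fun h => hxb.ne h.1)] at h1
      have hca : c ≠ a := by rintro rfl; exact o.asymm ho.1 h2
      rw [e2 _ _ (fun h => hca h.1)] at h2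
      exact hca (hs x b c a hx h1 h2 (hmin' x hxb) hb)
    · intro z c hz h1 h2
      rcases lt_trichotomy c a with h | rfl | h
      · exact o'.asymm hb (o'.trans h1 (o'.barred_lt _ _ h))
      · exact o'.asymm hb h1
      · exact o'.asymm h2 (hmax' _ _ h)
  refine ⟨?_, hclear⟩
  intro x z c c' hxz h1 h2 h3 h4
  by_cases hxb : x = b
  · subst hxb
    -- After undoing the swap, the gap above `b` contains `ā` alone.
    have : ∀ c, o.lt (.unbarred x) (.barred c) → o.lt (.barred c) (.unbarred z) → c = a := by
      intro c h1 h2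
      by_contra hca
      rw [e1 _ _ (fun h => hca h.2)] at h1
      rw [e2 _ _ (fun h => hca h.1)] at h2
      exact hclear.above z c hxz h1 h2
    rw [this c h1 h2, this c' h3 h4]
  by_cases hzb : z = b
  · subst hzb
    exact absurd h2 (hclear.below x c hxz h1)
  rw [e1 _ _ (fun h => hxb h.1)] at h1 h3
  rw [e2 _ _ (fun h => hzb h.2)] at h2 h4
  exact hs x z c c' hxz h1 h2 h3 h4

/-- The counterpart for the barred part, with the choices made in the other order: `b` is the least
unbarred letter above some barred letter, and `ā` the largest barred letter below `b`. -/
theorem exists_swap_before' (hne : o' ≠ bigBarOrder N) :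
    ∃ o b a, DifferBySwap o o' b a ∧
      (SparseUnbarred o' → SparseUnbarred o ∧ ClearAroundBarred o o' a) := by
  have h0 : ∃ b a, o'.lt (.barred a) (.unbarred b) := by
    by_contra hn
    push Not at hn
    exact hne (eq_bigBarOrder fun b a => hn b a)
  obtain ⟨b, hb0, hmin⟩ := exists_min_fin h0
  obtain ⟨a, ha, hmax⟩ := exists_max_fin hb0
  have hmin' : ∀ c d, d < b → o'.lt (.unbarred d) (.barred c) := fun c d hd =>
    (o'.lt_or_lt (by simp)).resolve_right fun hl => absurd (hmin d ⟨c, hl⟩) (not_le.mpr hd)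
  have hmax' : ∀ c, a < c → o'.lt (.unbarred b) (.barred c) := fun c hc =>
    (o'.lt_or_lt (by simp)).resolve_right fun hl => absurd (hmax c hl) (not_le.mpr hc)
  obtain ⟨o, ho⟩ := exists_differBySwap_symm (o' := o') ha (by
    rintro (z | z) h1 h2
    · exact o'.asymm h1 (hmin' a z (o'.unbarred_lt_iff.mp h2))
    · exact o'.asymm h2 (hmax' z (o'.barred_lt_iff.mp h1)))
  refine ⟨o, b, a, ho, fun hs => ?_⟩
  have e1 : ∀ d c, ¬ (d = b ∧ c = a) → (o.lt (.unbarred d) (.barred c) ↔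
      o'.lt (.unbarred d) (.barred c)) := fun d c h =>
    ho.2.2 _ _ (by simpa using h) (by simp)
  have e2 : ∀ d c, ¬ (c = a ∧ d = b) → (o.lt (.barred c) (.unbarred d) ↔
      o'.lt (.barred c) (.unbarred d)) := fun d c h =>
    ho.2.2 _ _ (by simp) (by simpa using h)
  have hclear : ClearAroundBarred o o' a := by
    constructor
    · intro x c hx h1 h2
      rcases lt_trichotomy c b with h | rfl | h
      · exact o'.asymm h1 (hmin' _ _ h)
      · exact o'.asymm ha h2
      · exact o'.asymm ha (o'.trans (o'.unbarred_lt _ _ h) h2)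
    · intro z c hz h1 h2
      have hza : a < z := Fin.lt_def.mpr (by omega)
      have hcb : c ≠ b := by rintro rfl; exact o.asymm ho.1 h1
      rw [e2 _ _ (fun h => hcb h.2)] at h1
      rw [e1 _ _ (fun h => hcb h.1)] at h2
      exact hcb (hs a z c b hz h1 h2 ha (hmax' z hza))
  refine ⟨?_, hclear⟩
  intro x z c c' hxz h1 h2 h3 h4
  by_cases hza : z = a
  · subst hza
    have : ∀ c, o.lt (.barred x) (.unbarred c) → o.lt (.unbarred c) (.barred z) → c = b := by
      intro c h1 h2
      by_contra hcb
      rw [e2 _ _ (fun h => hcb h.2)] at h1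
      rw [e1 _ _ (fun h => hcb h.1)] at h2
      exact hclear.below x c hxz h1 h2
    rw [this c h1 h2, this c' h3 h4]
  by_cases hxa : x = a
  · subst hxa
    exact absurd h2 (hclear.above z c hxz h1)
  rw [e2 _ _ (fun h => hxa h.1)] at h1 h3
  rw [e1 _ _ (fun h => hza h.2)] at h2 h4
  exact hs x z c c' hxz h1 h2 h3 h4

/-- A swap moving a barred letter down, with no other barred letter close to the unbarred one. -/
def ClearSwap (o o' : ShuffleOrder N) : Prop :=
  ∃ b a, DifferBySwap o o' b a ∧ ClearAround o o' b

/-- A swap moving a barred letter down, with no other unbarred letter close to the barred one. -/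
def ClearSwapBarred (o o' : ShuffleOrder N) : Prop :=
  ∃ b a, DifferBySwap o o' b a ∧ ClearAroundBarred o o' a

theorem reflTransGen_differBySwap (o : ShuffleOrder N) :
    ReflTransGen (fun o o' : ShuffleOrder N => ∃ b a, DifferBySwap o o' b a)
      (bigBarOrder N) o := by
  induction hn : inversions o using Nat.strong_induction_on generalizing o with
  | _ n ih =>
    by_cases h : o = bigBarOrder N
    · rw [h]
    · obtain ⟨o₁, b, a, h₁, _⟩ := exists_swap_before h
      exact (ih _ (hn ▸ h₁.inversions_lt) o₁ rfl).tail ⟨b, a, h₁⟩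

theorem reflTransGen_clearSwap (o : ShuffleOrder N) (ho : SparseBarred o) :
    ReflTransGen ClearSwap (bigBarOrder N) o := by
  induction hn : inversions o using Nat.strong_induction_on generalizing o with
  | _ n ih =>
    by_cases h : o = bigBarOrder N
    · rw [h]
    · obtain ⟨o₁, b, a, h₁, h₂⟩ := exists_swap_before h
      exact (ih _ (hn ▸ h₁.inversions_lt) o₁ (h₂ ho).1 rfl).tail ⟨b, a, h₁, (h₂ ho).2⟩

theorem reflTransGen_clearSwapBarred (o : ShuffleOrder N) (ho : SparseUnbarred o) :
    ReflTransGen ClearSwapBarred (bigBarOrder N) o := by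
  induction hn : inversions o using Nat.strong_induction_on generalizing o with
  | _ n ih =>
    by_cases h : o = bigBarOrder N
    · rw [h]
    · obtain ⟨o₁, b, a, h₁, h₂⟩ := exists_swap_before' h
      exact (ih _ (hn ▸ h₁.inversions_lt) o₁ (h₂ ho).1 rfl).tail ⟨b, a, h₁, (h₂ ho).2⟩

end ColoredTableaux

/-! ### Ribbons and single conversion steps -/

namespace ColoredTableaux
open Relation

/-- A graded partial injection of a finite type extends to a permutation which closes each chain
up to a cycle; it is stated for the inverse `τ`, with `top` the upper end of a chain. -/
theorem exists_rotation {X : Type*} [Finite X] (S : X → X → Prop) (deg : X → ℤ)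
    (hdeg : ∀ c d, S c d → deg c < deg d) (det : ∀ c d d', S c d → S c d' → d = d')
    (codet : ∀ c c' d, S c d → S c' d → c = c') :
    ∃ (top : X → X) (τ : Equiv.Perm X), (∀ c, ReflTransGen S c (top c)) ∧
      (∀ c d, ¬ S (top c) d) ∧ (∀ c d, S c d → top c = top d) ∧ (∀ c d, S c d → τ d = c) ∧
      ∀ d, (∀ c, ¬ S c d) → τ d = top d := by
  classical
  have h1 : ∀ c, ∃ t, ReflTransGen S c t ∧ ∀ d, ¬ S t d := by
    intro c
    obtain ⟨t, ht, hmax⟩ := Set.exists_max_image {t | ReflTransGen S c t} deg (Set.toFinite _)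
      ⟨c, ReflTransGen.refl⟩
    exact ⟨t, ht, fun d hd => absurd (hmax d (ReflTransGen.tail ht hd)) (not_le.mpr (hdeg _ _ hd))⟩
  choose top htop hend using h1
  have hstuck : ∀ t d, (∀ d, ¬ S t d) → ReflTransGen S t d → d = t := by
    intro t d ht h
    rcases h.cases_head with h | ⟨e, he, _⟩
    · exact h.symm
    · exact absurd he (ht e)
  have huniq : ∀ c t, ReflTransGen S c t → (∀ d, ¬ S t d) → t = top c := by
    intro c t h ht
    rcases ReflTransGen.total_of_right_unique (r := S) (fun _ _ _ h h' => det _ _ _ h h') h (htop c) with h' | h'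
    · exact (hstuck _ _ ht h').symm
    · exact hstuck _ _ (hend c) h'
  let τ : X → X := fun d => if h : ∃ c, S c d then h.choose else top d
  have τ1 : ∀ c d, S c d → τ d = c := by
    intro c d h
    have hex : ∃ c, S c d := ⟨c, h⟩
    simp only [τ, dif_pos hex]
    exact codet _ _ _ hex.choose_spec h
  have τ2 : ∀ d, (∀ c, ¬ S c d) → τ d = top d := by
    intro d h
    simp only [τ]
    rw [dif_neg]
    push Not
    exact h
  have hsw : ∀ d e, ReflTransGen S d e → (∀ c, ¬ S c e) → d = e := by
    intro d e h he
    rcases h.cases_tail with h | ⟨c, _, hc⟩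
    · exact h.symm
    · exact absurd hc (he c)
  have hinj : Function.Injective τ := by
    intro d e h
    by_cases hd : ∃ c, S c d <;> by_cases he : ∃ c, S c e
    · obtain ⟨c, hc⟩ := hd
      obtain ⟨c', hc'⟩ := he
      rw [τ1 _ _ hc, τ1 _ _ hc'] at h
      subst h
      exact det _ _ _ hc hc'
    · obtain ⟨c, hc⟩ := hd
      push Not at he
      rw [τ1 _ _ hc, τ2 _ he] at h
      exact absurd (h ▸ hc) (hend e d)
    · obtain ⟨c, hc⟩ := he
      push Not at hd
      rw [τ1 _ _ hc, τ2 _ hd] at h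
      exact absurd (h ▸ hc) (hend d e)
    -- Going down from a common top is also deterministic, so both elements lie on one chain;
    -- neither has anything below it, so they agree.
    · push Not at hd he
      rw [τ2 _ hd, τ2 _ he] at h
      have h1 := reflTransGen_swap.mpr (htop d)
      have h2 := reflTransGen_swap.mpr (htop e)
      rw [← h] at h2
      rcases ReflTransGen.total_of_right_unique
        (r := Function.swap S) (fun a b c h h' => codet _ _ _ h h') h1 h2 with h' | h'
      · exact (hsw _ _ (reflTransGen_swap.mp h') hd).symm
      · exact hsw _ _ (reflTransGen_swap.mp h') he
  refine ⟨top, Equiv.ofBijective τ (Finite.injective_iff_bijective.mp hinj), htop, hend, ?_, τ1, τ2⟩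
  intro c d h
  exact (huniq c (top d) (ReflTransGen.head h (htop d)) (hend d)).symm

variable {N : ℕ} {ν : YoungDiagram} {o o' : ShuffleOrder N} {b a : Fin N} {T T' : Filling N ν}

instance : Finite ν := Finite.of_injective (β := ν.cells) (fun c => ⟨c.1, c.2⟩) (by
  intro c d h
  exact Subtype.ext (congrArg (fun x : ν.cells => x.1) h))

theorem mem_of_le {i j : ℕ} (d : ν) (h1 : i ≤ d.1.1) (h2 : j ≤ d.1.2) : (i, j) ∈ ν :=
  ν.up_left_mem h1 h2 d.2

/-! ### Components -/

theorem component_symm {R : Set ν} {c d : ν} (h : d ∈ component R c) : c ∈ component R d := by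
  refine ReflTransGen.mono ?_ _ _ (reflTransGen_swap.mpr h)
  rintro x y ⟨h1, h2, h3⟩
  refine ⟨h2, h1, ?_⟩
  unfold BoxAdj at *
  omega

theorem mem_component_self {R : Set ν} (c : ν) : c ∈ component R c := ReflTransGen.refl

theorem component_trans {R : Set ν} {c d e : ν} (h : d ∈ component R c) (h' : e ∈ component R d) :
    e ∈ component R c := ReflTransGen.trans h h'

theorem component_subset {R : Set ν} {c d : ν} (hc : c ∈ R) (h : d ∈ component R c) : d ∈ R := by
  rcases ReflTransGen.cases_tail h with h | ⟨_, _, h⟩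
  · exact h ▸ hc
  · exact h.2.1

theorem eq_of_mem_component {R : Set ν} {c d : ν} (hc : c ∉ R) (h : d ∈ component R c) :
    d = c := by
  rcases ReflTransGen.cases_head h with h | ⟨_, h, _⟩
  · exact h.symm
  · exact absurd h.1 hc

/-- `d` is the right or the upper neighbour of `c`, both in `R`. -/
def Next (R : Set ν) (c d : ν) : Prop :=
  c ∈ R ∧ d ∈ R ∧
    ((c.1.1 = d.1.1 ∧ c.1.2 + 1 = d.1.2) ∨ (c.1.2 = d.1.2 ∧ d.1.1 + 1 = c.1.1))

theorem boxAdj_iff_next {R : Set ν} {c d : ν} :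
    (c ∈ R ∧ d ∈ R ∧ BoxAdj c.1 d.1) ↔ Next R c d ∨ Next R d c := by
  unfold Next BoxAdj
  constructor
  · rintro ⟨h1, h2, h3⟩
    simp only [h1, h2, true_and]
    omega
  · rintro (⟨h1, h2, h3⟩ | ⟨h1, h2, h3⟩) <;> refine ⟨by assumption, by assumption, ?_⟩ <;> omega

theorem mem_component_of_next {R : Set ν} {c d : ν} (h : Next R c d) : d ∈ component R c :=
  ReflTransGen.single (boxAdj_iff_next.mpr (Or.inl h))

theorem mem_component_of_chain {R : Set ν} {c d : ν} (h : ReflTransGen (Next R) c d) :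
    d ∈ component R c :=
  ReflTransGen.mono (fun _ _ h => boxAdj_iff_next.mpr (Or.inl h)) _ _ h

/-- With unique successors and predecessors, each further step of an undirected path either
lengthens the chain or retraces it. -/
theorem chain_of_mem_component {R : Set ν} (det : ∀ c d d', Next R c d → Next R c d' → d = d')
    (codet : ∀ c c' d, Next R c d → Next R c' d → c = c') {c d : ν} (h : d ∈ component R c) :
    ReflTransGen (Next R) c d ∨ ReflTransGen (Next R) d c := by
  induction h with
  | refl => exact Or.inl .refl
  | tail _ hxy ih =>
    rcases boxAdj_iff_next.mp hxy with hxy | hxy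
    · rcases ih with ih | ih
      · exact Or.inl (ih.tail hxy)
      · rcases ih.cases_head with rfl | ⟨z, hz, hzc⟩
        · exact Or.inl (.single hxy)
        · rw [det _ _ _ hxy hz]; exact Or.inr hzc
    · rcases ih with ih | ih
      · rcases ih.cases_tail with rfl | ⟨z, hcz, hz⟩
        · exact Or.inr (.single hxy)
        · rw [codet _ _ _ hxy hz]; exact Or.inl hcz
      · exact Or.inr (.head hxy ih)

theorem refills_comp (τ : Equiv.Perm ν) (hτ : ∀ d, τ d ∈ component (ribbon T b a) d) :
    Refills b a T (T ∘ τ) := by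
  refine ⟨fun c hc => by simp [eq_of_mem_component hc (hτ c)], fun c _ => ?_⟩
  have key : ∀ x : Letter N, {d ∈ component (ribbon T b a) c | (T ∘ τ) d = x}.ncard =
      {d ∈ component (ribbon T b a) c | T d = x}.ncard := by
    intro x
    rw [← Set.ncard_image_of_injective _ τ.injective]
    congr 1
    ext d
    constructor
    · rintro ⟨e, ⟨h1, h2⟩, rfl⟩
      exact ⟨component_trans h1 (hτ e), h2⟩
    · rintro ⟨h1, h2⟩
      refine ⟨τ.symm d, ⟨?_, by simpa using h2⟩, by simp⟩
      have := hτ (τ.symm d)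
      rw [Equiv.apply_symm_apply] at this
      exact component_trans h1 (component_symm this)
  exact ⟨key _, key _⟩

/-! ### Refillings and colored tableaux -/

/-- The two prescribed counts already add up to the size of the component, which leaves no box for a
third letter. -/
theorem Refills.mem_or (h : Refills b a T T') {c : ν} (hc : c ∈ ribbon T b a) :
    T' c = .unbarred b ∨ T' c = .barred a := by
  obtain ⟨h1, h2⟩ := h.2 c hc
  set K := component (ribbon T b a) c with hK
  have hdisj : ∀ F : Filling N ν, Disjoint {d ∈ K | F d = .unbarred b} {d ∈ K | F d = .barred a} := by
    intro F
    rw [Set.disjoint_left]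
    rintro x ⟨_, h⟩ ⟨_, h'⟩
    rw [h] at h'
    exact absurd h' (by simp)
  have e1 := Set.ncard_union_eq (hdisj T) (Set.toFinite _) (Set.toFinite _)
  have e2 := Set.ncard_union_eq (hdisj T') (Set.toFinite _) (Set.toFinite _)
  have e3 : {d ∈ K | T d = .unbarred b} ∪ {d ∈ K | T d = .barred a} = K := by
    ext d
    constructor
    · rintro (h | h) <;> exact h.1
    · intro hd
      rcases component_subset hc hd with h | h
      · exact Or.inl ⟨hd, h⟩
      · exact Or.inr ⟨hd, h⟩
  have e4 : {d ∈ K | T' d = .unbarred b} ∪ {d ∈ K | T' d = .barred a} = K := by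
    apply Set.eq_of_subset_of_ncard_le
    · rintro d (h | h) <;> exact h.1
    · rw [e2, h1, h2, ← e1, e3]
    · exact Set.toFinite _
  have : c ∈ K := mem_component_self c
  rw [← e4] at this
  exact this.imp (fun h => h.2) (fun h => h.2)

theorem Refills.ribbon_eq (h : Refills b a T T') : ribbon T' b a = ribbon T b a := by
  ext c
  constructor
  · intro hc
    by_contra hn
    rw [ribbon, Set.mem_ofPred_eq, h.1 c hn] at hc
    exact hn hc
  · exact fun hc => h.mem_or hc

theorem Refills.symm (h : Refills b a T T') : Refills b a T' T := by
  have e := h.ribbon_eq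
  refine ⟨fun c hc => ?_, fun c hc => ?_⟩
  · rw [e] at hc
    exact (h.1 c hc).symm
  · rw [e] at hc ⊢
    exact ⟨(h.2 c hc).1.symm, (h.2 c hc).2.symm⟩

theorem IsColored.row_le (hT : IsColored o T) {c d : ν} (h1 : c.1.1 = d.1.1) (h2 : c.1.2 ≤ d.1.2) :
    o.rank (T c) ≤ o.rank (T d) := by
  rcases h2.eq_or_lt with h | h
  · rw [show c = d from Subtype.ext (Prod.ext h1 h)]
  · rcases hT.row_weak c d h1 h with h | h
    · rw [h]
    · exact (o.rank_lt h).le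

theorem IsColored.col_le (hT : IsColored o T) {c d : ν} (h1 : c.1.2 = d.1.2) (h2 : c.1.1 ≤ d.1.1) :
    o.rank (T c) ≤ o.rank (T d) := by
  rcases h2.eq_or_lt with h | h
  · rw [show c = d from Subtype.ext (Prod.ext h h1)]
  · rcases hT.col_weak c d h1 h with h | h
    · rw [h]
    · exact (o.rank_lt h).le

theorem IsColored.mono (hT : IsColored o T) {c d : ν} (h1 : c.1.1 ≤ d.1.1) (h2 : c.1.2 ≤ d.1.2) :
    o.rank (T c) ≤ o.rank (T d) := by
  have hm : (c.1.1, d.1.2) ∈ ν := mem_of_le d h1 le_rfl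
  exact (hT.row_le (c := c) (d := ⟨_, hm⟩) rfl h2).trans
    (hT.col_le (c := ⟨_, hm⟩) (d := d) rfl h1)

/-- Any other letter lies below both `b` and `ā` or above both, so monotonicity excludes it between
two boxes of the ribbon. -/
theorem mem_ribbon_of_between (hT : IsColored o T) (hs : SameSide o b a) {c m d : ν}
    (hc : c ∈ ribbon T b a) (hd : d ∈ ribbon T b a) (h1 : c.1.1 ≤ m.1.1) (h2 : c.1.2 ≤ m.1.2)
    (h3 : m.1.1 ≤ d.1.1) (h4 : m.1.2 ≤ d.1.2) : m ∈ ribbon T b a := by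
  by_contra hm
  simp only [ribbon, Set.mem_ofPred_eq, not_or] at hm hc hd
  have e := hs (T m) hm.1 hm.2
  have l1 := hT.mono h1 h2
  have l2 := hT.mono h3 h4
  have n1 := o.rank_ne hm.1
  have n2 := o.rank_ne hm.2
  simp only [o.lt_iff] at e
  rcases hc with hc | hc <;> rcases hd with hd | hd <;> rw [hc] at l1 <;> rw [hd] at l2 <;> omega

/-- Since `ā` cannot repeat in a row, the rows force one column of the square to consist of `b`'s:
the left one if `b ⋖ ā`, the right one otherwise. But `b` cannot repeat in a column. -/
theorem not_square (hT : IsColored o T) {p q r s : ν} (hp : p ∈ ribbon T b a)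
    (hq : q ∈ ribbon T b a) (hr : r ∈ ribbon T b a) (hs : s ∈ ribbon T b a)
    (h1 : q.1 = (p.1.1, p.1.2 + 1)) (h2 : r.1 = (p.1.1 + 1, p.1.2))
    (h3 : s.1 = (p.1.1 + 1, p.1.2 + 1)) : False := by
  have r1 := hT.row_weak p q (by simp [h1]) (by simp [h1])
  have r2 := hT.row_weak r s (by simp [h2, h3]) (by simp [h2, h3])
  have r1' := hT.row_strict p q (by simp [h1]) (by simp [h1])
  have r2' := hT.row_strict r s (by simp [h2, h3]) (by simp [h2, h3])
  have c1' := hT.col_strict p r (by simp [h2]) (by simp [h2])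
  have c2' := hT.col_strict q s (by simp [h1, h3]) (by simp [h1, h3])
  have hasymm := o.asymm (x := .unbarred b) (y := .barred a)
  rcases hp with hp | hp <;> rcases hq with hq | hq <;> rcases hr with hr | hr <;>
    rcases hs with hs | hs <;> simp_all [Letter.isBarred]

/-- A right and an upper neighbour would complete, with the box at their common corner, a square
inside the ribbon. -/
theorem next_det (hT : IsColored o T) (hs : SameSide o b a) (c d d' : ν)
    (h : Next (ribbon T b a) c d) (h' : Next (ribbon T b a) c d') : d = d' := by
  have key : ∀ d d' : ν, Next (ribbon T b a) c d → Next (ribbon T b a) c d' →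
      c.1.1 = d.1.1 → c.1.2 + 1 = d.1.2 → c.1.2 = d'.1.2 → d'.1.1 + 1 = c.1.1 → False := by
    intro d d' h h' e1 e2 e3 e4
    have hm : (d'.1.1, d.1.2) ∈ ν := mem_of_le d (by omega) le_rfl
    refine not_square hT h'.2.1 (q := ⟨_, hm⟩) ?_ h.1 h.2.1 (by ext <;> simp; omega)
      (by ext <;> simp <;> omega) (by ext <;> simp <;> omega)
    exact mem_ribbon_of_between hT hs h'.2.1 h.2.1 le_rfl (by simp; omega) (by simp; omega) le_rfl
  rcases h.2.2 with ⟨e1, e2⟩ | ⟨e1, e2⟩ <;> rcases h'.2.2 with ⟨e3, e4⟩ | ⟨e3, e4⟩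
  · exact Subtype.ext (Prod.ext (by omega) (by omega))
  · exact (key d d' h h' e1 e2 e3 e4).elim
  · exact (key d' d h' h e3 e4 e1 e2).elim
  · exact Subtype.ext (Prod.ext (by omega) (by omega))

theorem next_codet (hT : IsColored o T) (hs : SameSide o b a) (c c' d : ν)
    (h : Next (ribbon T b a) c d) (h' : Next (ribbon T b a) c' d) : c = c' := by
  have key : ∀ c c' : ν, Next (ribbon T b a) c d → Next (ribbon T b a) c' d →
      c.1.1 = d.1.1 → c.1.2 + 1 = d.1.2 → c'.1.2 = d.1.2 → d.1.1 + 1 = c'.1.1 → False := by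
    intro c c' h h' e1 e2 e3 e4
    have hm : (c'.1.1, c.1.2) ∈ ν := mem_of_le c' le_rfl (by omega)
    refine not_square hT h.1 h.2.1 (r := ⟨_, hm⟩) ?_ h'.1 (by ext <;> simp <;> omega)
      (by ext <;> simp; omega) (by ext <;> simp <;> omega)
    exact mem_ribbon_of_between hT hs h.1 h'.1 (by simp; omega) le_rfl le_rfl (by simp; omega)
  rcases h.2.2 with ⟨e1, e2⟩ | ⟨e1, e2⟩ <;> rcases h'.2.2 with ⟨e3, e4⟩ | ⟨e3, e4⟩
  · exact Subtype.ext (Prod.ext (by omega) (by omega))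
  · exact (key c c' h h' e1 e2 e3 e4).elim
  · exact (key c' c h' h e3 e4 e1 e2).elim
  · exact Subtype.ext (Prod.ext (by omega) (by omega))

section Forced
variable {c d : ν}

/-- In this section, letters are forced because `ā` cannot repeat in a row nor `b` in a column. For
`b ⋖ ā` this leaves only the northeastern end of a component free, for `ā ⋖ b` only the southwestern
end. -/
theorem IsColored.row_left (hT : IsColored o T) (hc : c ∈ ribbon T b a) (hd : d ∈ ribbon T b a)
    (hlt : o.lt (.unbarred b) (.barred a)) (h1 : c.1.1 = d.1.1) (h2 : c.1.2 < d.1.2) :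
    T c = .unbarred b := by
  have r := hT.row_weak c d h1 h2
  have r' := hT.row_strict c d h1 h2
  have := o.asymm hlt
  rcases hc with hc | hc <;> rcases hd with hd | hd <;> simp_all [Letter.isBarred]

theorem IsColored.col_lower (hT : IsColored o T) (hc : c ∈ ribbon T b a) (hd : d ∈ ribbon T b a)
    (hlt : o.lt (.unbarred b) (.barred a)) (h1 : c.1.2 = d.1.2) (h2 : c.1.1 < d.1.1) :
    T d = .barred a := by
  have r := hT.col_weak c d h1 h2
  have r' := hT.col_strict c d h1 h2
  have := o.asymm hlt
  rcases hc with hc | hc <;> rcases hd with hd | hd <;> simp_all [Letter.isBarred]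

theorem IsColored.row_right (hT : IsColored o T) (hc : c ∈ ribbon T b a) (hd : d ∈ ribbon T b a)
    (hlt : o.lt (.barred a) (.unbarred b)) (h1 : c.1.1 = d.1.1) (h2 : c.1.2 < d.1.2) :
    T d = .unbarred b := by
  have r := hT.row_weak c d h1 h2
  have r' := hT.row_strict c d h1 h2
  have := o.asymm hlt
  rcases hc with hc | hc <;> rcases hd with hd | hd <;> simp_all [Letter.isBarred]

theorem IsColored.col_upper (hT : IsColored o T) (hc : c ∈ ribbon T b a) (hd : d ∈ ribbon T b a)
    (hlt : o.lt (.barred a) (.unbarred b)) (h1 : c.1.2 = d.1.2) (h2 : c.1.1 < d.1.1) :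
    T c = .barred a := by
  have r := hT.col_weak c d h1 h2
  have r' := hT.col_strict c d h1 h2
  have := o.asymm hlt
  rcases hc with hc | hc <;> rcases hd with hd | hd <;> simp_all [Letter.isBarred]

end Forced

theorem lt_iff_of_swap (h : DifferBySwap o o' b a ∨ DifferBySwap o' o b a) {x x' z : Letter N}
    (hz : z ≠ .unbarred b ∧ z ≠ .barred a) (hx : x = .unbarred b ∨ x = .barred a)
    (hx' : x' = .unbarred b ∨ x' = .barred a) :
    (o.lt z x ↔ o'.lt z x') ∧ (o.lt x z ↔ o'.lt x' z) := by
  have hs : SameSide o b a := h.elim (·.sameSide_left) (·.sameSide_right)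
  have e : ∀ u v, (u = z ∨ v = z) → (o.lt u v ↔ o'.lt u v) := by
    intro u v huv
    rcases h with h | h
    · apply h.2.2 <;> rcases huv with rfl | rfl <;> simp [hz.1, hz.2]
    · refine (h.2.2 u v ?_ ?_).symm <;> rcases huv with rfl | rfl <;> simp [hz.1, hz.2]
  rw [← e _ _ (Or.inl rfl), ← e _ _ (Or.inr rfl)]
  have s := hs z hz.1 hz.2
  have n1 := o.rank_ne hz.1
  have n2 := o.rank_ne hz.2
  simp only [o.lt_iff] at s ⊢
  rcases hx with rfl | rfl <;> rcases hx' with rfl | rfl <;> omega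

theorem lt_iff_of_swap_of_ne (h : DifferBySwap o o' b a ∨ DifferBySwap o' o b a) {x z : Letter N}
    (hx : x ≠ .unbarred b ∧ x ≠ .barred a) : o.lt x z ↔ o'.lt x z := by
  rcases h with h | h
  · apply h.2.2 <;> simp [hx.1, hx.2]
  · refine (h.2.2 x z ?_ ?_).symm <;> simp [hx.1, hx.2]

/-- A filling which agrees with a colored tableau outside a ribbon only has to be checked inside
the ribbon. -/
theorem isColored_of_ribbon (h : DifferBySwap o o' b a ∨ DifferBySwap o' o b a)
    (hT : IsColored o T) (hout : ∀ c, c ∉ ribbon T b a → T' c = T c)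
    (hin : ∀ c, c ∈ ribbon T b a → T' c = .unbarred b ∨ T' c = .barred a)
    (hrow : ∀ c d : ν, c ∈ ribbon T b a → d ∈ ribbon T b a → c.1.1 = d.1.1 → c.1.2 < d.1.2 →
      (T' c = T' d ∨ o'.lt (T' c) (T' d)) ∧ ((T' c).isBarred = true → T' c ≠ T' d))
    (hcol : ∀ c d : ν, c ∈ ribbon T b a → d ∈ ribbon T b a → c.1.2 = d.1.2 → c.1.1 < d.1.1 →
      (T' c = T' d ∨ o'.lt (T' c) (T' d)) ∧ ((T' c).isBarred = false → T' c ≠ T' d)) :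
    IsColored o' T' := by
  have key : ∀ (c d : ν) (β : Bool), ¬ (c ∈ ribbon T b a ∧ d ∈ ribbon T b a) →
      (T c = T d ∨ o.lt (T c) (T d)) → ((T c).isBarred = β → T c ≠ T d) →
      (T' c = T' d ∨ o'.lt (T' c) (T' d)) ∧ ((T' c).isBarred = β → T' c ≠ T' d) := by
    intro c d β hcd h1 h2
    by_cases hc : c ∈ ribbon T b a
    · have hd : d ∉ ribbon T b a := fun hd => hcd ⟨hc, hd⟩
      have hd' := not_or.mp hd
      have hne : T c ≠ T d := fun e => hd (by rcases hc with hc | hc <;> rw [hc] at e <;>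
        simp [ribbon, ← e])
      have hne' : T' c ≠ T' d := fun e => by
        rw [hout d hd] at e
        rcases hin c hc with hc | hc <;> rw [hc] at e <;> exact hd (by simp [ribbon, ← e])
      refine ⟨Or.inr ?_, fun _ => hne'⟩
      rw [hout d hd]
      exact (lt_iff_of_swap h hd' hc (hin c hc)).2.mp (h1.resolve_left hne)
    · have hc' := not_or.mp hc
      by_cases hd : d ∈ ribbon T b a
      · have hne : T c ≠ T d := fun e => hc (by rcases hd with hd | hd <;> rw [hd] at e <;>
          simp [ribbon, e])
        have hne' : T' c ≠ T' d := fun e => by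
          rw [hout c hc] at e
          rcases hin d hd with hd | hd <;> rw [hd] at e <;> exact hc (by simp [ribbon, e])
        refine ⟨Or.inr ?_, fun _ => hne'⟩
        rw [hout c hc]
        exact (lt_iff_of_swap h hc' hd (hin d hd)).1.mp (h1.resolve_left hne)
      · rw [hout c hc, hout d hd]
        refine ⟨h1.imp id fun h1 => ?_, h2⟩
        exact (lt_iff_of_swap_of_ne h hc').mp h1
  constructor
  · intro c d h1 h2
    by_cases hcd : c ∈ ribbon T b a ∧ d ∈ ribbon T b a
    · exact (hrow c d hcd.1 hcd.2 h1 h2).1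
    · exact (key c d true hcd (hT.row_weak c d h1 h2) (hT.row_strict c d h1 h2)).1
  · intro c d h1 h2
    by_cases hcd : c ∈ ribbon T b a ∧ d ∈ ribbon T b a
    · exact (hcol c d hcd.1 hcd.2 h1 h2).1
    · exact (key c d false hcd (hT.col_weak c d h1 h2) (hT.col_strict c d h1 h2)).1
  · intro c d h1 h2
    by_cases hcd : c ∈ ribbon T b a ∧ d ∈ ribbon T b a
    · exact (hrow c d hcd.1 hcd.2 h1 h2).2
    · exact (key c d true hcd (hT.row_weak c d h1 h2) (hT.row_strict c d h1 h2)).2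
  · intro c d h1 h2
    by_cases hcd : c ∈ ribbon T b a ∧ d ∈ ribbon T b a
    · exact (hcol c d hcd.1 hcd.2 h1 h2).2
    · exact (key c d false hcd (hT.col_weak c d h1 h2) (hT.col_strict c d h1 h2)).2

theorem next_deg {R : Set ν} {c d : ν} (h : Next R c d) :
    (c.1.2 : ℤ) - c.1.1 < (d.1.2 : ℤ) - d.1.1 := by
  rcases h.2.2 with h | h <;> omega

/-- Conversion of `b ⋖ ā` to `ā ⋖ b`. The function `e` gives the letter of `T` at the northeastern
end of a component, which is also the letter of `T'` at its southwestern end. -/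
theorem exists_refill (h : DifferBySwap o o' b a) (hT : IsColored o T) :
    ∃ T' : Filling N ν, IsColored o' T' ∧ Refills b a T T' ∧ ∃ e : ν → Letter N,
      (∀ c d, Next (ribbon T b a) c d → e c = e d) ∧
      (∀ c, (∀ d, ¬ Next (ribbon T b a) c d) → e c = T c) ∧
      (∀ d, (∀ c, ¬ Next (ribbon T b a) c d) → e d = T' d) := by
  have hs := h.sameSide_left
  obtain ⟨top, τ, h1, h2, h3, h4, h5⟩ := exists_rotation (Next (ribbon T b a))
    (fun c : ν => (c.1.2 : ℤ) - c.1.1) (fun _ _ => next_deg) (next_det hT hs) (next_codet hT hs)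
  have hτ : ∀ d, τ d ∈ component (ribbon T b a) d := by
    intro d
    by_cases hd : ∃ c, Next (ribbon T b a) c d
    · obtain ⟨c, hc⟩ := hd
      rw [h4 c d hc]
      exact component_symm (mem_component_of_next hc)
    · push Not at hd
      rw [h5 d hd]
      exact mem_component_of_chain (h1 d)
  have hR := refills_comp τ hτ
  refine ⟨T ∘ τ, ?_, hR, T ∘ top, fun c d hcd => ?_, fun c hc => ?_, fun d hd => ?_⟩
  -- Here `τ` goes one step back along the chain. A box with a ribbon box to its left thus receives
  -- the letter of its left neighbour, which was forced to be `b`; a box with one below it receives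
  -- a forced `ā`. These are the letters required when `ā ⋖ b`.
  · have hrow : ∀ c d : ν, c ∈ ribbon T b a → d ∈ ribbon T b a → c.1.1 = d.1.1 → c.1.2 < d.1.2 →
        (T ∘ τ) d = .unbarred b := by
      intro c d hc hd e1 e2
      have hm : (d.1.1, d.1.2 - 1) ∈ ν := mem_of_le d le_rfl (by omega)
      have hmR : (⟨_, hm⟩ : ν) ∈ ribbon T b a :=
        mem_ribbon_of_between hT hs hc hd (by simp; omega) (by simp; omega) le_rfl (by simp)
      have hn : Next (ribbon T b a) ⟨_, hm⟩ d := ⟨hmR, hd, Or.inl ⟨rfl, by simp; omega⟩⟩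
      simp only [Function.comp_apply, h4 _ _ hn]
      exact hT.row_left hmR hd h.1 rfl (by simp; omega)
    have hcol : ∀ c d : ν, c ∈ ribbon T b a → d ∈ ribbon T b a → c.1.2 = d.1.2 → c.1.1 < d.1.1 →
        (T ∘ τ) c = .barred a := by
      intro c d hc hd e1 e2
      have hm : (c.1.1 + 1, c.1.2) ∈ ν := mem_of_le d (by omega) (by omega)
      have hmR : (⟨_, hm⟩ : ν) ∈ ribbon T b a :=
        mem_ribbon_of_between hT hs hc hd (by simp) le_rfl (by simp; omega) (by simp; omega)
      have hn : Next (ribbon T b a) ⟨_, hm⟩ c := ⟨hmR, hc, Or.inr ⟨rfl, rfl⟩⟩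
      simp only [Function.comp_apply, h4 _ _ hn]
      exact hT.col_lower hc hmR h.1 rfl (by simp)
    refine isColored_of_ribbon (Or.inl h) hT hR.1 (fun c hc => hR.mem_or hc) ?_ ?_
    · intro c d hc hd e1 e2
      rw [hrow c d hc hd e1 e2]
      rcases hR.mem_or hc with h' | h' <;> rw [h'] <;> simp [Letter.isBarred, h.2.1]
    · intro c d hc hd e1 e2
      rw [hcol c d hc hd e1 e2]
      rcases hR.mem_or hd with h' | h' <;> rw [h'] <;> simp [Letter.isBarred, h.2.1]
  · simp only [Function.comp_apply, h3 c d hcd]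
  · rcases (h1 c).cases_head with h' | ⟨d, hd, _⟩
    · simp only [Function.comp_apply, ← h']
    · exact absurd hd (hc d)
  · simp only [Function.comp_apply, h5 d hd]

/-- Conversion of `ā ⋖ b` to `b ⋖ ā`. -/
theorem exists_refill_symm (h : DifferBySwap o o' b a) (hT : IsColored o' T) :
    ∃ T' : Filling N ν, IsColored o T' ∧ Refills b a T T' := by
  have hs := h.sameSide_right
  -- The inverse rotation: the chains are traversed from northeast to southwest.
  obtain ⟨top, τ, h1, h2, h3, h4, h5⟩ := exists_rotation (fun c d => Next (ribbon T b a) d c)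
    (fun c : ν => (c.1.1 : ℤ) - c.1.2) (fun _ _ h => by have := next_deg h; omega)
    (fun c d d' h h' => next_codet hT hs _ _ _ h h') (fun c d d' h h' => next_det hT hs _ _ _ h h')
  have hτ : ∀ d, τ d ∈ component (ribbon T b a) d := by
    intro d
    by_cases hd : ∃ c, Next (ribbon T b a) d c
    · obtain ⟨c, hc⟩ := hd
      rw [h4 c d hc]
      exact mem_component_of_next hc
    · push Not at hd
      rw [h5 d hd]
      exact component_symm (mem_component_of_chain (reflTransGen_swap.mp (h1 d)))
  have hR := refills_comp τ hτ
  refine ⟨T ∘ τ, ?_, hR⟩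
  have hrow : ∀ c d : ν, c ∈ ribbon T b a → d ∈ ribbon T b a → c.1.1 = d.1.1 → c.1.2 < d.1.2 →
      (T ∘ τ) c = .unbarred b := by
    intro c d hc hd e1 e2
    have hm : (c.1.1, c.1.2 + 1) ∈ ν := mem_of_le d (by omega) (by omega)
    have hmR : (⟨_, hm⟩ : ν) ∈ ribbon T b a :=
      mem_ribbon_of_between hT hs hc hd le_rfl (by simp) (by simp; omega) (by simp; omega)
    have hn : Next (ribbon T b a) c ⟨_, hm⟩ := ⟨hc, hmR, Or.inl ⟨rfl, rfl⟩⟩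
    simp only [Function.comp_apply, h4 _ _ hn]
    exact hT.row_right hc hmR h.2.1 rfl (by simp)
  have hcol : ∀ c d : ν, c ∈ ribbon T b a → d ∈ ribbon T b a → c.1.2 = d.1.2 → c.1.1 < d.1.1 →
      (T ∘ τ) d = .barred a := by
    intro c d hc hd e1 e2
    have hm : (d.1.1 - 1, d.1.2) ∈ ν := mem_of_le d (by omega) le_rfl
    have hmR : (⟨_, hm⟩ : ν) ∈ ribbon T b a :=
      mem_ribbon_of_between hT hs hc hd (by simp; omega) (by simp; omega) (by simp) (by simp)
    have hn : Next (ribbon T b a) d ⟨_, hm⟩ := ⟨hd, hmR, Or.inr ⟨rfl, by simp; omega⟩⟩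
    simp only [Function.comp_apply, h4 _ _ hn]
    exact hT.col_upper hmR hd h.2.1 rfl (by simp; omega)
  refine isColored_of_ribbon (Or.inr h) hT hR.1 (fun c hc => hR.mem_or hc) ?_ ?_
  · intro c d hc hd e1 e2
    rw [hrow c d hc hd e1 e2]
    rcases hR.mem_or hd with h' | h' <;> rw [h'] <;> simp [Letter.isBarred, h.1]
  · intro c d hc hd e1 e2
    rw [hcol c d hc hd e1 e2]
    rcases hR.mem_or hc with h' | h' <;> rw [h'] <;> simp [Letter.isBarred, h.1]

end ColoredTableaux

/-! ### Independence of the sequence of swaps -/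

namespace ColoredTableaux
open Relation

variable {N : ℕ} {ν : YoungDiagram} {o o' o₁ o₂ : ShuffleOrder N} {b a b' a' : Fin N}
  {T T' T₁ T₂ T₃ : Filling N ν}

/-- If only the box `c` is in doubt, its letter is recovered from the total number of `b`'s. -/
theorem eq_of_component_count {R : Set ν} {c : ν}
    (h1 : T₁ c = .unbarred b ∨ T₁ c = .barred a) (h2 : T₂ c = .unbarred b ∨ T₂ c = .barred a)
    (hother : ∀ d ∈ component R c, d ≠ c → T₁ d = T₂ d)
    (hcount : {d ∈ component R c | T₁ d = .unbarred b}.ncard =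
      {d ∈ component R c | T₂ d = .unbarred b}.ncard) : T₁ c = T₂ c := by
  have key : ∀ T₁ T₂ : Filling N ν, (∀ d ∈ component R c, d ≠ c → T₁ d = T₂ d) →
      T₁ c = .unbarred b → T₂ c = .barred a →
      {d ∈ component R c | T₂ d = .unbarred b}.ncard <
        {d ∈ component R c | T₁ d = .unbarred b}.ncard := by
    intro T₁ T₂ hother h1 h2
    apply Set.ncard_lt_ncard _ (Set.toFinite _)
    constructor
    · rintro d ⟨hd, hb⟩
      have hne : d ≠ c := by rintro rfl; rw [h2] at hb; cases hb
      exact ⟨hd, by rw [hother d hd hne, hb]⟩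
    · intro hs
      have := (hs (a := c) ⟨mem_component_self c, h1⟩).2
      rw [h2] at this
      cases this
  rcases h1 with h1 | h1 <;> rcases h2 with h2 | h2
  · rw [h1, h2]
  · exact absurd hcount (key T₁ T₂ hother h1 h2).ne'
  · exact absurd hcount (key T₂ T₁ (fun d hd hne => (hother d hd hne).symm) h2 h1).ne
  · rw [h1, h2]

/-- A filling of a ribbon with `ā ⋖ b` is determined by the content of the components. -/
theorem eq_of_ribbon_count (h₁ : IsColored o₁ T₁) (h₂ : IsColored o₂ T₂) (hs : SameSide o₁ b a)
    (hlt₁ : o₁.lt (.barred a) (.unbarred b)) (hlt₂ : o₂.lt (.barred a) (.unbarred b))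
    (hR : ribbon T₁ b a = ribbon T₂ b a)
    (hcount : ∀ c ∈ ribbon T₁ b a, {d ∈ component (ribbon T₁ b a) c | T₁ d = .unbarred b}.ncard =
      {d ∈ component (ribbon T₁ b a) c | T₂ d = .unbarred b}.ncard) :
    ∀ c ∈ ribbon T₁ b a, T₁ c = T₂ c := by
  -- Every box with a predecessor is forced, so a disagreement can only occur at the southwestern
  -- end, and there the count decides.
  have hforced : ∀ c d, Next (ribbon T₁ b a) c d → T₁ d = T₂ d := by
    rintro c d ⟨hc, hd, ⟨e1, e2⟩ | ⟨e1, e2⟩⟩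
    · rw [h₁.row_right hc hd hlt₁ e1 (by omega),
        h₂.row_right (hR ▸ hc) (hR ▸ hd) hlt₂ e1 (by omega)]
    · rw [h₁.col_upper hd hc hlt₁ e1.symm (by omega),
        h₂.col_upper (hR ▸ hd) (hR ▸ hc) hlt₂ e1.symm (by omega)]
  intro c hc
  by_contra hne
  refine hne (eq_of_component_count hc (hR ▸ hc : c ∈ ribbon T₂ b a) ?_ (hcount c hc))
  intro d hd hdc
  rcases chain_of_mem_component (next_det h₁ hs) (next_codet h₁ hs) hd with h | h
  · rcases h.cases_tail with h | ⟨x, _, hx⟩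
    · exact absurd h hdc
    · exact hforced x d hx
  · rcases h.cases_tail with h | ⟨x, _, hx⟩
    · exact absurd h.symm hdc
    · exact absurd (hforced x c hx) hne

/-- A filling of a ribbon with `b ⋖ ā` is determined by the content of the components. -/
theorem eq_of_ribbon_count_symm (h₁ : IsColored o₁ T₁) (h₂ : IsColored o₂ T₂)
    (hs : SameSide o₁ b a)
    (hlt₁ : o₁.lt (.unbarred b) (.barred a)) (hlt₂ : o₂.lt (.unbarred b) (.barred a))
    (hR : ribbon T₁ b a = ribbon T₂ b a)
    (hcount : ∀ c ∈ ribbon T₁ b a, {d ∈ component (ribbon T₁ b a) c | T₁ d = .unbarred b}.ncard =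
      {d ∈ component (ribbon T₁ b a) c | T₂ d = .unbarred b}.ncard) :
    ∀ c ∈ ribbon T₁ b a, T₁ c = T₂ c := by
  have hforced : ∀ c d, Next (ribbon T₁ b a) c d → T₁ c = T₂ c := by
    rintro c d ⟨hc, hd, ⟨e1, e2⟩ | ⟨e1, e2⟩⟩
    · rw [h₁.row_left hc hd hlt₁ e1 (by omega),
        h₂.row_left (hR ▸ hc) (hR ▸ hd) hlt₂ e1 (by omega)]
    · rw [h₁.col_lower hd hc hlt₁ e1.symm (by omega),
        h₂.col_lower (hR ▸ hd) (hR ▸ hc) hlt₂ e1.symm (by omega)]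
  intro c hc
  by_contra hne
  refine hne (eq_of_component_count hc (hR ▸ hc : c ∈ ribbon T₂ b a) ?_ (hcount c hc))
  intro d hd hdc
  rcases chain_of_mem_component (next_det h₁ hs) (next_codet h₁ hs) hd with h | h
  · rcases h.cases_head with h | ⟨x, hx, _⟩
    · exact absurd h.symm hdc
    · exact absurd (hforced c x hx) hne
  · rcases h.cases_head with h | ⟨x, hx, _⟩
    · exact absurd h hdc
    · exact hforced d x hx

/-- A step of conversion which moves `ā` below `b`. -/
def SwapStep (b a : Fin N) (p q : ShuffleOrder N × Filling N ν) : Prop :=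
  DifferBySwap p.1 q.1 b a ∧ IsColored p.1 p.2 ∧ IsColored q.1 q.2 ∧ Refills b a p.2 q.2

/-- A step of conversion which moves some barred letter down. -/
def DownStep (p q : ShuffleOrder N × Filling N ν) : Prop := ∃ b a, SwapStep b a p q

theorem DownStep.convertStep {p q : ShuffleOrder N × Filling N ν} (h : DownStep p q) :
    ConvertStep p q := by
  obtain ⟨b, a, h1, h2⟩ := h
  exact ⟨b, a, Or.inl h1, h2⟩

theorem ConvertStep.symm {p q : ShuffleOrder N × Filling N ν} (h : ConvertStep p q) :
    ConvertStep q p := by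
  obtain ⟨b, a, h1, h2, h3, h4⟩ := h
  exact ⟨b, a, h1.symm, h3, h2, h4.symm⟩

theorem convertStep_iff {p q : ShuffleOrder N × Filling N ν} :
    ConvertStep p q ↔ DownStep p q ∨ DownStep q p := by
  constructor
  · rintro ⟨b, a, h1 | h1, h2, h3, h4⟩
    · exact Or.inl ⟨b, a, h1, h2, h3, h4⟩
    · exact Or.inr ⟨b, a, h1, h3, h2, h4.symm⟩
  · rintro (h | h)
    · exact h.convertStep
    · exact h.convertStep.symm

theorem refill_unique (h : DifferBySwap o o' b a) (h₁ : IsColored o' T₁) (h₂ : IsColored o' T₂)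
    (r₁ : Refills b a T T₁) (r₂ : Refills b a T T₂) : T₁ = T₂ := by
  funext c
  by_cases hc : c ∈ ribbon T b a
  · refine eq_of_ribbon_count h₁ h₂ h.sameSide_right h.2.1 h.2.1 ?_ ?_ c (r₁.ribbon_eq ▸ hc)
    · rw [r₁.ribbon_eq, r₂.ribbon_eq]
    · intro c hc
      rw [r₁.ribbon_eq] at hc ⊢
      rw [(r₁.2 c hc).1, (r₂.2 c hc).1]
  · rw [r₁.1 c hc, r₂.1 c hc]

theorem refill_unique_symm (h : DifferBySwap o o' b a) (h₁ : IsColored o T₁) (h₂ : IsColored o T₂)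
    (r₁ : Refills b a T T₁) (r₂ : Refills b a T T₂) : T₁ = T₂ := by
  funext c
  by_cases hc : c ∈ ribbon T b a
  · refine eq_of_ribbon_count_symm h₁ h₂ h.sameSide_left h.1 h.1 ?_ ?_ c (r₁.ribbon_eq ▸ hc)
    · rw [r₁.ribbon_eq, r₂.ribbon_eq]
    · intro c hc
      rw [r₁.ribbon_eq] at hc ⊢
      rw [(r₁.2 c hc).1, (r₂.2 c hc).1]
  · rw [r₁.1 c hc, r₂.1 c hc]

theorem SwapStep.right_unique {p q r : ShuffleOrder N × Filling N ν} (h : SwapStep b a p q)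
    (h' : SwapStep b a p r) : q = r := by
  obtain ⟨o, T⟩ := p
  obtain ⟨o₁, T₁⟩ := q
  obtain ⟨o₂, T₂⟩ := r
  obtain rfl : o₁ = o₂ := h.1.right_unique h'.1
  exact congrArg (Prod.mk o₁) (refill_unique h.1 h.2.2.1 h'.2.2.1 h.2.2.2 h'.2.2.2)

theorem not_mem_ribbon_of_ne (hb : b ≠ b') (ha : a ≠ a') {c : ν} (hc : c ∈ ribbon T b a) :
    c ∉ ribbon T b' a' := by
  rintro (h | h) <;> rcases hc with hc | hc <;> rw [hc] at h <;> simp_all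

theorem Refills.ribbon_eq_of_ne (h : Refills b a T T') (hb : b ≠ b') (ha : a ≠ a') :
    ribbon T' b' a' = ribbon T b' a' := by
  ext c
  by_cases hc : c ∈ ribbon T b a
  · have h1 := not_mem_ribbon_of_ne hb ha hc
    have h2 := not_mem_ribbon_of_ne hb ha (T := T') (h.ribbon_eq ▸ hc : c ∈ ribbon T' b a)
    exact iff_of_false h2 h1
  · simp only [ribbon, Set.mem_ofPred_eq, h.1 c hc]

/-- Without a common letter the two ribbons are disjoint. The other refilling therefore changes
neither this ribbon nor the content of its components, and these determine the result. -/
theorem refill_commute (hb : b ≠ b') (ha : a ≠ a') (r₁ : Refills b a T T₁)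
    (r₂ : Refills b' a' T T₂) (r₃ : Refills b a T₂ T₃) (h₁ : IsColored o₁ T₁)
    (h₃ : IsColored o₂ T₃) (hs : SameSide o₁ b a) (hlt₁ : o₁.lt (.barred a) (.unbarred b))
    (hlt₂ : o₂.lt (.barred a) (.unbarred b)) : ∀ c ∈ ribbon T b a, T₁ c = T₃ c := by
  have e2 : ribbon T₂ b a = ribbon T b a := r₂.ribbon_eq_of_ne hb.symm ha.symm
  have e3 : ribbon T₃ b a = ribbon T b a := by rw [r₃.ribbon_eq, e2]
  intro c hc
  refine eq_of_ribbon_count h₁ h₃ hs hlt₁ hlt₂ (by rw [r₁.ribbon_eq, e3]) ?_ c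
    (r₁.ribbon_eq ▸ hc)
  intro c hc
  rw [r₁.ribbon_eq] at hc ⊢
  have h := (r₃.2 c (e2 ▸ hc)).1
  rw [e2] at h
  rw [h, (r₁.2 c hc).1]
  congr 1
  ext d
  refine and_congr_right fun hd => ?_
  rw [r₂.1 d (not_mem_ribbon_of_ne hb ha (component_subset hc hd))]

/-- Steps of conversion for different pairs of letters commute. -/
theorem SwapStep.diamond {p p₁ p₂ : ShuffleOrder N × Filling N ν} (h₁ : SwapStep b a p p₁)
    (h₂ : SwapStep b' a' p p₂) (hne : ¬ (b = b' ∧ a = a')) :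
    ∃ q, SwapStep b' a' p₁ q ∧ SwapStep b a p₂ q := by
  obtain ⟨o, T⟩ := p
  obtain ⟨o₁, T₁⟩ := p₁
  obtain ⟨o₂, T₂⟩ := p₂
  obtain ⟨d₁, c, c₁, r₁⟩ := h₁
  obtain ⟨d₂, _, c₂, r₂⟩ := h₂
  simp only at *
  obtain ⟨hb, ha⟩ := d₁.ne_of_ne d₂ hne
  obtain ⟨o₃, d₃, d₃'⟩ := d₁.diamond d₂ hne
  obtain ⟨T₃, c₃, r₃, _⟩ := exists_refill d₃ c₁
  obtain ⟨T₃', c₃', r₃', _⟩ := exists_refill d₃' c₂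
  have e1 := refill_commute hb ha r₁ r₂ r₃' c₁ c₃' d₁.sameSide_right d₁.2.1 d₃'.2.1
  have e2 := refill_commute hb.symm ha.symm r₂ r₁ r₃ c₂ c₃ d₂.sameSide_right d₂.2.1 d₃.2.1
  have hR1 : ribbon T₁ b' a' = ribbon T b' a' := r₁.ribbon_eq_of_ne hb ha
  have hR2 : ribbon T₂ b a = ribbon T b a := r₂.ribbon_eq_of_ne hb.symm ha.symm
  have : T₃ = T₃' := by
    funext x
    by_cases hx : x ∈ ribbon T b a
    · have hx' := not_mem_ribbon_of_ne hb ha hx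
      rw [← e1 x hx, r₃.1 x (hR1 ▸ hx')]
    by_cases hx' : x ∈ ribbon T b' a'
    · rw [← e2 x hx', r₃'.1 x (hR2 ▸ hx)]
    rw [r₃.1 x (hR1 ▸ hx'), r₃'.1 x (hR2 ▸ hx), r₁.1 x hx, r₂.1 x hx']
  subst this
  exact ⟨(o₃, T₃), ⟨d₃, c₁, c₃, r₃⟩, ⟨d₃', c₂, c₃', r₃'⟩⟩

theorem lt_of_downSteps {p q : ShuffleOrder N × Filling N ν} (h : ReflTransGen DownStep p q)
    (hp : p.1.lt (.barred a) (.unbarred b)) : q.1.lt (.barred a) (.unbarred b) := by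
  induction h with
  | refl => exact hp
  | tail _ hs ih =>
    obtain ⟨d, c, hs, _⟩ := hs
    by_cases he : a = c ∧ b = d
    · obtain ⟨rfl, rfl⟩ := he; exact hs.2.1
    · exact (hs.2.2 _ _ (by simp) (by simpa using he)).mp ih

/-- A downward sequence that brings `ā` below `b` has to swap this pair somewhere; repeated use of
`SwapStep.diamond` moves that swap to the front. -/
theorem exchange_downSteps {p q p₁ : ShuffleOrder N × Filling N ν}
    (h : ReflTransGen DownStep p q) (h₁ : SwapStep b a p p₁)
    (hq : q.1.lt (.barred a) (.unbarred b)) : ReflTransGen DownStep p₁ q := by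
  induction h using ReflTransGen.head_induction_on generalizing p₁ with
  | refl => exact absurd hq (q.1.asymm h₁.1.1)
  | head hs htail ih =>
    obtain ⟨d, c, hs⟩ := hs
    by_cases he : b = d ∧ a = c
    · obtain ⟨rfl, rfl⟩ := he
      rwa [h₁.right_unique hs]
    · obtain ⟨r, hr1, hr2⟩ := h₁.diamond hs he
      exact .head ⟨d, c, hr1⟩ (ih hr2)

/-- An inversion created by a downward step persists. So the first step of one sequence inverts a
pair which the other must invert too, and by exchange it can be made the first step of both. -/
theorem downSteps_unique {p : ShuffleOrder N × Filling N ν}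
    (h₁ : ReflTransGen DownStep p (o, T₁)) (h₂ : ReflTransGen DownStep p (o, T₂)) : T₁ = T₂ := by
  induction h₁ using ReflTransGen.head_induction_on with
  | refl =>
    rcases h₂.cases_head with h | ⟨r, ⟨b, a, hr⟩, hr2⟩
    · exact congrArg Prod.snd h
    · exact absurd (lt_of_downSteps hr2 hr.1.2.1) (o.asymm hr.1.1)
  | head hs htail ih =>
    obtain ⟨b, a, hs⟩ := hs
    have hlt := lt_of_downSteps htail hs.1.2.1
    exact ih (exchange_downSteps h₂ hs hlt)

/-- Conversions along sequences of swaps of any kind lift sequences of orders. -/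
theorem exists_downSteps {P : ShuffleOrder N → ShuffleOrder N → Prop}
    (hP : ∀ o o', P o o' → ∃ b a, DifferBySwap o o' b a) (h : ReflTransGen P o o')
    (hT : IsColored o T) : ∃ T', IsColored o' T' ∧
      ReflTransGen (fun p q : ShuffleOrder N × Filling N ν => DownStep p q ∧ P p.1 q.1)
        (o, T) (o', T') := by
  induction h with
  | refl => exact ⟨T, hT, .refl⟩
  | tail _ hs ih =>
    obtain ⟨T₁, h1, h2⟩ := ih
    obtain ⟨b, a, hd⟩ := hP _ _ hs
    obtain ⟨T₂, h3, h4, _⟩ := exists_refill hd h1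
    exact ⟨T₂, h3, h2.tail ⟨⟨b, a, hd, h1, h3, h4⟩, hs⟩⟩

theorem exists_downSteps_symm (h : ReflTransGen
      (fun o o' : ShuffleOrder N => ∃ b a, DifferBySwap o o' b a) o o')
    (hT : IsColored o' T') : ∃ T : Filling N ν, IsColored o T ∧
      ReflTransGen DownStep (o, T) (o', T') := by
  induction h using ReflTransGen.head_induction_on with
  | refl => exact ⟨T', hT, .refl⟩
  | head hs _ ih =>
    obtain ⟨T₁, h1, h2⟩ := ih
    obtain ⟨b, a, hd⟩ := hs
    obtain ⟨T₂, h3, h4⟩ := exists_refill_symm hd h1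
    exact ⟨T₂, h3, .head ⟨b, a, hd, h3, h1, h4.symm⟩ h2⟩

/-- Every conversion which starts at the big bar order can be replaced by one which only moves
barred letters down. -/
theorem downSteps_of_convertSteps {p q : ShuffleOrder N × Filling N ν}
    (hp : p.1 = bigBarOrder N) (hT : IsColored p.1 p.2) (h : ReflTransGen ConvertStep p q) :
    ReflTransGen DownStep p q := by
  induction h with
  | refl => exact .refl
  | tail _ hs ih =>
    rename_i r s _
    rcases convertStep_iff.mp hs with hs | hs
    · exact ih.tail hs
    · obtain ⟨b, a, hs⟩ := hs
      obtain ⟨o, T⟩ := p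
      obtain ⟨o₁, T₁⟩ := r
      obtain ⟨o₂, T₂⟩ := s
      simp only at hp
      subst hp
      -- The last step goes up, from `o₁` to `o₂`. A fresh downward conversion to `o₂`, continued
      -- down to `o₁`, must end at `T₁` by uniqueness; as the last refilling is reversible, the
      -- fresh tableau at `o₂` is `T₂`.
      obtain ⟨T₃, h1, h2⟩ := exists_downSteps (fun _ _ h => h) (reflTransGen_differBySwap o₂) hT
      have h2 := ReflTransGen.mono (fun _ _ h => h.1) _ _ h2
      obtain ⟨h0, h0', h0'', h0'''⟩ := hs
      obtain ⟨T₄, h3, h4, _⟩ := exists_refill h0 h1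
      have h5 : T₄ = T₁ :=
        downSteps_unique (h2.tail (c := (o₁, T₄)) ⟨b, a, h0, h1, h3, h4⟩) ih
      subst h5
      have h6 : T₃ = T₂ := refill_unique_symm h0 h1 h0' h4.symm h0'''.symm
      exact h6 ▸ h2

theorem convertsTo_unique (hT : IsColored (bigBarOrder N) T)
    (h₁ : ConvertsTo (bigBarOrder N) o T T₁) (h₂ : ConvertsTo (bigBarOrder N) o T T₂) :
    T₁ = T₂ :=
  downSteps_unique (downSteps_of_convertSteps rfl hT h₁) (downSteps_of_convertSteps rfl hT h₂)

end ColoredTableaux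

/-! ### Row reading words under a conversion step -/

namespace ColoredTableaux
open Relation

section Balance
open Classical in
/-- The letters `b` which enter and leave the rows of a ribbon in a conversion. Here `R` is the
ribbon, `B` and `B'` are the boxes with `b` before and after, and `e` says whether the letter
which travels along the component is a `b`. -/
theorem exists_transfer (m : ℕ) (R B B' e : ℕ → ℕ → Prop)
    (hB : ∀ i j, B i j → R i j) (hB' : ∀ i j, B' i j → R i j)
    (conv : ∀ i j x k, R i j → R i k → j ≤ x → x ≤ k → R i x) (bound : ∀ i j, R i j → j < m)
    (left : ∀ i j k, R i j → R i k → j < k → B i j)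
    (low : ∀ i j, R i j → R (i + 1) j → ¬ B (i + 1) j)
    (right : ∀ i j k, R i j → R i k → j < k → B' i k)
    (up : ∀ i j, R i j → R (i + 1) j → ¬ B' i j)
    (erow : ∀ i j, R i j → R i (j + 1) → (e i j ↔ e i (j + 1)))
    (ecol : ∀ i j, R i j → R (i + 1) j → (e i j ↔ e (i + 1) j))
    (eend : ∀ i j, R i j → ¬ R i (j + 1) → (∀ k, i = k + 1 → ¬ R k j) → (e i j ↔ B i j))
    (estart : ∀ i j, R i j → (∀ k, j = k + 1 → ¬ R i k) → ¬ R (i + 1) j → (e i j ↔ B' i j)) :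
    ∃ t : ℕ → ℕ, (∀ i, t i ≤ 1) ∧ (∀ i, t i = 1 → ∃ l, R i l ∧ R (i + 1) l) ∧
      ((Finset.range m).filter (B 0)).card = ((Finset.range m).filter (B' 0)).card + t 0 ∧
      ∀ i, ((Finset.range m).filter (B (i + 1))).card + t i =
        ((Finset.range m).filter (B' (i + 1))).card + t (i + 1) := by
  -- A component joins row `i - 1` to row `i`, and the letter travelling along it is a `b`.
  let P : ℕ → Prop := fun i => ∃ k l, i = k + 1 ∧ R k l ∧ R i l ∧ e i l
  let tp : ℕ → ℕ := fun i => if P i then 1 else 0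
  have erow' : ∀ i j k, R i j → R i k → j ≤ k → (e i j ↔ e i k) := by
    intro i j k hj hk hjk
    induction k, hjk using Nat.le_induction with
    | base => rfl
    | succ k hjk ih =>
      have hk' := conv i j k (k + 1) hj hk hjk (by omega)
      rw [ih hk', erow i k hk' hk]
  have erow'' : ∀ i j k, R i j → R i k → (e i j ↔ e i k) := by
    intro i j k hj hk
    rcases le_total j k with h | h
    · exact erow' i j k hj hk h
    · exact (erow' i k j hk hj h).symm
  have key : ∀ i, ((Finset.range m).filter (B i)).card + tp i =
      ((Finset.range m).filter (B' i)).card + tp (i + 1) := by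
    intro i
    by_cases hne : ∃ j, R i j
    · set Ri := (Finset.range m).filter (R i) with hRi
      have hmem : ∀ j, j ∈ Ri ↔ R i j := fun j => by
        rw [hRi, Finset.mem_filter, Finset.mem_range]
        exact ⟨fun h => h.2, fun h => ⟨bound i j h, h⟩⟩
      have hRne : Ri.Nonempty := hne.imp fun j hj => (hmem j).mpr hj
      obtain ⟨r, hr, hrmax⟩ : ∃ r, R i r ∧ ∀ j, R i j → j ≤ r :=
        ⟨Ri.max' hRne, (hmem _).mp (Ri.max'_mem _), fun j hj => Ri.le_max' j ((hmem j).mpr hj)⟩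
      obtain ⟨l, hl, hlmin⟩ : ∃ r, R i r ∧ ∀ j, R i j → r ≤ j :=
        ⟨Ri.min' hRne, (hmem _).mp (Ri.min'_mem _), fun j hj => Ri.min'_le j ((hmem j).mpr hj)⟩
      -- Before conversion all ribbon boxes of the row except possibly the rightmost contain `b`. If
      -- the rightmost does not, it is either joined to the row above, or it is the northeastern end
      -- and the travelling letter is no `b`; so the missing unit is `tp i` or the last term.
      have c1 : ((Finset.range m).filter (B i)).card + tp i + (if e i r then 0 else 1) =
          Ri.card := by
        by_cases hBr : B i r
        · have h1 : (Finset.range m).filter (B i) = Ri := by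
            ext j
            rw [hmem, Finset.mem_filter, Finset.mem_range]
            refine ⟨fun h => hB _ _ h.2, fun h => ⟨bound _ _ h, ?_⟩⟩
            rcases (hrmax j h).eq_or_lt with h' | h'
            · rwa [h']
            · exact left i j r h hr h'
          have hall : ∀ j, R i j → B i j := fun j hj => by
            rw [← hmem, ← h1, Finset.mem_filter] at hj; exact hj.2
          have h2 : e i r := by
            rw [eend i r hr]
            · exact hBr
            · intro h; have := hrmax _ h; omega
            · rintro k rfl h; exact low k r h hr hBr
          have h3 : ¬ P i := by
            rintro ⟨k, l, rfl, h3, h4, _⟩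
            exact low k l h3 h4 (hall l h4)
          simp [tp, h3, h2, h1]
        · have h1 : (Finset.range m).filter (B i) = Ri.erase r := by
            ext j
            rw [Finset.mem_erase, hmem, Finset.mem_filter, Finset.mem_range]
            refine ⟨fun h => ⟨?_, hB _ _ h.2⟩, fun h => ⟨bound _ _ h.2, ?_⟩⟩
            · rintro rfl; exact hBr h.2
            · exact left i j r h.2 hr (lt_of_le_of_ne (hrmax j h.2) h.1)
          have h2 : P i ↔ e i r := by
            constructor
            · rintro ⟨k, l, rfl, h3, h4, h5⟩
              rwa [erow'' _ r l hr h4]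
            · intro he
              by_contra hn
              rw [eend i r hr] at he
              · exact hBr he
              · intro h; have := hrmax _ h; omega
              · rintro k rfl h; exact hn ⟨k, r, rfl, h, hr, he⟩
          rw [h1]
          have := Finset.card_erase_add_one ((hmem r).mpr hr)
          by_cases he : e i r
          · simp [tp, h2, he, this]
          · simp [tp, h2, he, this]
      -- The mirror count after conversion: the leftmost box is the exceptional one, and the link is
      -- to the row below.
      have c2 : ((Finset.range m).filter (B' i)).card + tp (i + 1) + (if e i r then 0 else 1) =
          Ri.card := by
        rw [erow'' i r l hr hl]
        have hlink : P (i + 1) → e i l := by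
          rintro ⟨k, x, h, h3, h4, h5⟩
          obtain rfl : i = k := by omega
          rw [erow'' _ l x hl h3]
          exact (ecol _ _ h3 h4).mpr h5
        by_cases hBl : B' i l
        · have h1 : (Finset.range m).filter (B' i) = Ri := by
            ext j
            rw [hmem, Finset.mem_filter, Finset.mem_range]
            refine ⟨fun h => hB' _ _ h.2, fun h => ⟨bound _ _ h, ?_⟩⟩
            rcases (hlmin j h).eq_or_lt with h' | h'
            · rwa [← h']
            · exact right i l j hl h h'
          have hall : ∀ j, R i j → B' i j := fun j hj => by
            rw [← hmem, ← h1, Finset.mem_filter] at hj; exact hj.2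
          have h2 : e i l := by
            rw [estart i l hl]
            · exact hBl
            · rintro k rfl h; have := hlmin _ h; omega
            · intro h; exact up i l hl h hBl
          have h3 : ¬ P (i + 1) := by
            rintro ⟨k, x, h, h3, h4, _⟩
            obtain rfl : i = k := by omega
            exact up i x h3 h4 (hall x h3)
          simp [tp, h3, h2, h1]
        · have h1 : (Finset.range m).filter (B' i) = Ri.erase l := by
            ext j
            rw [Finset.mem_erase, hmem, Finset.mem_filter, Finset.mem_range]
            refine ⟨fun h => ⟨?_, hB' _ _ h.2⟩, fun h => ⟨bound _ _ h.2, ?_⟩⟩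
            · rintro rfl; exact hBl h.2
            · exact right i l j hl h.2 (lt_of_le_of_ne (hlmin j h.2) (Ne.symm h.1))
          have h2 : P (i + 1) ↔ e i l := by
            refine ⟨hlink, fun he => ?_⟩
            by_contra hn
            have he' := he
            rw [estart i l hl] at he
            · exact hBl he
            · rintro k rfl h; have := hlmin _ h; omega
            · intro h; exact hn ⟨i, l, rfl, hl, h, (ecol i l hl h).mp he'⟩
          rw [h1]
          have := Finset.card_erase_add_one ((hmem l).mpr hl)
          by_cases he : e i l
          · simp [tp, h2, he, this]
          · simp [tp, h2, he, this]
      omega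
    · push Not at hne
      have h1 : ∀ j, ¬ B i j := fun j h => hne j (hB _ _ h)
      have h2 : ∀ j, ¬ B' i j := fun j h => hne j (hB' _ _ h)
      have h3 : ¬ P i := by rintro ⟨k, l, _, _, h, _⟩; exact hne l h
      have h4 : ¬ P (i + 1) := by
        rintro ⟨k, l, h, h', _⟩
        obtain rfl : i = k := by omega
        exact hne l h'
      simp [tp, h1, h2, h3, h4]
  refine ⟨fun i => tp (i + 1), fun i => ?_, fun i hi => ?_, ?_, fun i => key (i + 1)⟩
  · by_cases h : P (i + 1) <;> simp [tp, h]
  · by_cases h : P (i + 1)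
    · obtain ⟨k, l, hk, h1, h2, _⟩ := h
      obtain rfl : i = k := by omega
      exact ⟨l, h1, h2⟩
    · simp [tp, h] at hi
  · have h0 : ¬ P 0 := by rintro ⟨k, l, hk, _⟩; omega
    have := key 0
    simpa [tp, h0] using this

end Balance

/-- The product of `F (n - 1), …, F 1, F 0`. -/
def descProd {M : Type*} [Monoid M] (F : ℕ → M) (n : ℕ) : M :=
  ((List.range n).reverse.map F).prod

theorem descProd_succ {M : Type*} [Monoid M] (F : ℕ → M) (n : ℕ) :
    descProd F (n + 1) = F n * descProd F n := by
  simp [descProd, List.range_succ]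

/-- Rows are converted from the top down. The surplus `t n` letters `y` are held in row `n` until
`hloc` passes them on to row `n + 1`, where the balance `hs` says what surplus remains. -/
theorem descProd_transfer {M : Type*} [Monoid M] {y : M} {A C : ℕ → M} {m m' t : ℕ → ℕ}
    (ht : ∀ i, t i ≤ 1) (h0 : m 0 = m' 0 + t 0) (hs : ∀ i, m (i + 1) + t i = m' (i + 1) + t (i + 1))
    (hloc : ∀ i, t i = 1 → y ^ m (i + 1) * C (i + 1) * A i * y ^ (m' i + 1) =
      y ^ (m (i + 1) + 1) * C (i + 1) * A i * y ^ m' i) (n : ℕ) :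
    descProd (fun i => A i * y ^ m i * C i) (n + 1) =
      A n * y ^ (m' n + t n) * C n * descProd (fun i => A i * y ^ m' i * C i) n := by
  induction n with
  | zero => rw [descProd_succ, h0]; simp [descProd]
  | succ n ih =>
    rw [descProd_succ, ih, descProd_succ, ← hs n]
    have : y ^ m (n + 1) * C (n + 1) * A n * y ^ (m' n + t n) =
        y ^ (m (n + 1) + t n) * C (n + 1) * A n * y ^ m' n := by
      rcases Nat.le_one_iff_eq_zero_or_eq_one.mp (ht n) with h | h
      · simp [h]
      · rw [h]; exact hloc n h
    calc _ = A (n + 1) * (y ^ m (n + 1) * C (n + 1) * A n * y ^ (m' n + t n)) * C n *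
          descProd (fun i => A i * y ^ m' i * C i) n := by simp only [mul_assoc]
      _ = _ := by rw [this]; simp only [mul_assoc]

/-! ### Rows of unbarred letters -/

variable {N : ℕ} {ν : YoungDiagram} {o o' : ShuffleOrder N} {b a : Fin N} {T T' : Filling N ν}

/-- The number of an unbarred letter. -/
def Letter.unbarred? : Letter N → Option ℕ
  | .unbarred a => some a.val
  | .barred _ => none

/-- The unbarred letter in a box, if there is one. -/
def uval (T : Filling N ν) (i j : ℕ) : Option ℕ :=
  if h : (i, j) ∈ ν then (T ⟨(i, j), h⟩).unbarred? else none

theorem uval_eq_some {i j x : ℕ} :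
    uval T i j = some x ↔ ∃ h : (i, j) ∈ ν, ∃ a : Fin N, T ⟨(i, j), h⟩ = .unbarred a ∧ a.val = x := by
  unfold uval
  by_cases h : (i, j) ∈ ν
  · rw [dif_pos h]
    simp only [h, exists_true_left]
    rcases T ⟨(i, j), h⟩ with c | c <;> simp [Letter.unbarred?]
  · simp [h]

theorem uval_eq_some_val {i j : ℕ} :
    uval T i j = some b.val ↔ ∃ h : (i, j) ∈ ν, T ⟨(i, j), h⟩ = .unbarred b := by
  rw [uval_eq_some]
  refine exists_congr fun h => ⟨?_, fun h' => ⟨b, h', rfl⟩⟩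
  rintro ⟨c, hc, hcb⟩
  rw [hc, Fin.ext hcb]

/-- The unbarred letters in row `i`, from left to right. -/
def rowList (T : Filling N ν) (i : ℕ) : List ℕ := (List.range (ν.rowLen 0)).filterMap (uval T i)

theorem lt_rowLen_zero {i j : ℕ} (h : (i, j) ∈ ν) : j < ν.rowLen 0 :=
  (YoungDiagram.mem_iff_lt_rowLen.mp h).trans_le (ν.rowLen_anti 0 i (Nat.zero_le i))

theorem lt_colLen_zero {i j : ℕ} (h : (i, j) ∈ ν) : i < ν.colLen 0 :=
  (YoungDiagram.mem_iff_lt_colLen.mp h).trans_le (ν.colLen_anti 0 j (Nat.zero_le j))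

theorem rowList_pairwise (hT : IsColored o T) (i : ℕ) : (rowList T i).Pairwise (· ≤ ·) := by
  rw [rowList, List.pairwise_filterMap]
  refine List.Pairwise.imp ?_ List.pairwise_lt_range
  intro j k hjk x hx y hy
  obtain ⟨h1, c, hc, rfl⟩ := uval_eq_some.mp hx
  obtain ⟨h2, d, hd, rfl⟩ := uval_eq_some.mp hy
  rcases hT.row_weak ⟨_, h1⟩ ⟨_, h2⟩ rfl hjk with h | h
  · rw [hc, hd] at h
    cases h
    exact le_rfl
  · rw [hc, hd, o.unbarred_lt_iff] at h
    exact h.le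

theorem count_filterMap_range (f : ℕ → Option ℕ) (x m : ℕ) :
    ((List.range m).filterMap f).count x = ((Finset.range m).filter (fun j => f j = some x)).card := by
  induction m with
  | zero => simp
  | succ m ih =>
    rw [List.range_succ, List.filterMap_append, List.count_append, ih, Finset.range_add_one,
      Finset.filter_insert]
    rcases h : f m with _ | y
    · simp [h]
    · by_cases hy : y = x
      · subst hy; simp [h]
      · simp [h, hy]

theorem count_rowList (i x : ℕ) : (rowList T i).count x =
    ((Finset.range (ν.rowLen 0)).filter (fun j => uval T i j = some x)).card :=
  count_filterMap_range _ _ _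

theorem count_rowList_le {i i' x y : ℕ}
    (h : ∀ j, uval T i j = some x → uval T' i' j = some y) :
    (rowList T i).count x ≤ (rowList T' i').count y := by
  rw [count_rowList, count_rowList]
  exact Finset.card_le_card fun j hj => by
    rw [Finset.mem_filter] at hj ⊢
    exact ⟨hj.1, h j hj.2⟩

theorem filter_rowList_eq (h : Refills b a T T') (i : ℕ) (p : ℕ → Bool) (hp : p b = false) :
    (rowList T i).filter p = (rowList T' i).filter p := by
  rw [rowList, rowList, List.filter_filterMap, List.filter_filterMap]
  congr 1
  funext j
  by_cases hj : (i, j) ∈ ν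
  · by_cases hR : (⟨(i, j), hj⟩ : ν) ∈ ribbon T b a
    · have e : ∀ F : Filling N ν, (F ⟨(i, j), hj⟩ = .unbarred b ∨ F ⟨(i, j), hj⟩ = .barred a) →
          (uval F i j).filter p = none := by
        rintro F (hF | hF) <;> simp [uval, hj, hF, Letter.unbarred?, hp]
      rw [e T hR, e T' (h.mem_or hR)]
    · simp only [uval, hj, dif_pos, h.1 _ hR]
  · simp only [uval, hj, dif_neg, not_false_eq_true]

theorem prod_rowList {M : Type*} [Monoid M] (g : ℕ → M) {l : List ℕ}
    (hl : l.Pairwise (· ≤ ·)) (b : ℕ) :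
    (l.map g).prod = ((l.filter (· < b)).map g).prod * g b ^ l.count b *
      ((l.filter (b < ·)).map g).prod := by
  conv_lhs => rw [sorted_eq_append hl b]
  simp [mul_assoc]

/-- The row reading word of the unbarred letters does not change in a conversion step, up to local
plactic equivalence, when no other barred letter is close to `b`. -/
theorem descProd_rowList_eq {M : Type*} [Monoid M] {g : ℕ → M} (hg : LocalPlactic g)
    (h : DifferBySwap o o' b a) (hclear : ClearAround o o' b) (hT : IsColored o T)
    (hT' : IsColored o' T') (hR : Refills b a T T') :
    descProd (fun i => ((rowList T i).map g).prod) (ν.colLen 0) =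
      descProd (fun i => ((rowList T' i).map g).prod) (ν.colLen 0) := by
  have hs := h.sameSide_left
  have hs' := h.sameSide_right
  obtain ⟨T₁, c₁, r₁, e, e1, e2, e3⟩ := exists_refill h hT
  obtain rfl := refill_unique h c₁ hT' r₁ hR
  obtain ⟨t, ht, hlink, hm0, hm⟩ := exists_transfer (ν.rowLen 0)
    (fun i j => ∃ h : (i, j) ∈ ν, (⟨(i, j), h⟩ : ν) ∈ ribbon T b a)
    (fun i j => uval T i j = some b.val) (fun i j => uval T₁ i j = some b.val)
    (fun i j => ∃ h : (i, j) ∈ ν, e ⟨(i, j), h⟩ = .unbarred b)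
    (fun i j hb => by
      obtain ⟨h1, h2⟩ := uval_eq_some_val.mp hb
      exact ⟨h1, Or.inl h2⟩)
    (fun i j hb => by
      obtain ⟨h1, h2⟩ := uval_eq_some_val.mp hb
      exact ⟨h1, hR.ribbon_eq ▸ Or.inl h2⟩)
    (by
      rintro i j x k ⟨h1, h1'⟩ ⟨h2, h2'⟩ h3 h4
      have hx : (i, x) ∈ ν := ν.up_left_mem le_rfl h4 h2
      exact ⟨hx, mem_ribbon_of_between hT hs h1' h2' le_rfl h3 le_rfl h4⟩)
    (fun i j hj => lt_rowLen_zero hj.1)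
    (by
      rintro i j k ⟨h1, h1'⟩ ⟨h2, h2'⟩ h3
      exact uval_eq_some_val.mpr ⟨h1, hT.row_left h1' h2' h.1 rfl h3⟩)
    (by
      rintro i j ⟨h1, h1'⟩ ⟨h2, h2'⟩ h3
      obtain ⟨_, h3⟩ := uval_eq_some_val.mp h3
      rw [hT.col_lower h1' h2' h.1 rfl (Nat.lt_succ_self i)] at h3
      cases h3)
    (by
      rintro i j k ⟨h1, h1'⟩ ⟨h2, h2'⟩ h3
      rw [← hR.ribbon_eq] at h1' h2'
      exact uval_eq_some_val.mpr ⟨h2, hT'.row_right h1' h2' h.2.1 rfl h3⟩)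
    (by
      rintro i j ⟨h1, h1'⟩ ⟨h2, h2'⟩ h3
      rw [← hR.ribbon_eq] at h1' h2'
      obtain ⟨_, h3⟩ := uval_eq_some_val.mp h3
      rw [hT'.col_upper h1' h2' h.2.1 rfl (Nat.lt_succ_self i)] at h3
      cases h3)
    (by
      rintro i j ⟨h1, h1'⟩ ⟨h2, h2'⟩
      simp only [h1, h2, exists_true_left, e1 _ _ ⟨h1', h2', Or.inl ⟨rfl, rfl⟩⟩])
    (by
      rintro i j ⟨h1, h1'⟩ ⟨h2, h2'⟩
      simp only [h1, h2, exists_true_left, e1 _ _ ⟨h2', h1', Or.inr ⟨rfl, rfl⟩⟩])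
    (by
      rintro i j ⟨h1, h1'⟩ h2 h3
      rw [uval_eq_some_val]
      simp only [h1, exists_true_left]
      rw [e2]
      rintro ⟨⟨i', j'⟩, hd⟩ ⟨_, hd', ⟨q1, q2⟩ | ⟨q1, q2⟩⟩
      · simp only at q1 q2; subst q1 q2; exact h2 ⟨hd, hd'⟩
      · simp only at q1 q2; subst q1; exact h3 i' q2.symm ⟨hd, hd'⟩)
    (by
      rintro i j ⟨h1, h1'⟩ h2 h3
      rw [uval_eq_some_val]
      simp only [h1, exists_true_left]
      rw [e3]
      rintro ⟨⟨i', j'⟩, hd⟩ ⟨hd', _, ⟨q1, q2⟩ | ⟨q1, q2⟩⟩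
      · simp only at q1 q2; subst q1; exact h2 j' q2.symm ⟨hd, hd'⟩
      · simp only at q1 q2; subst q1 q2; exact h3 ⟨hd, hd'⟩)
  have hcount : ∀ (F : Filling N ν) (i : ℕ), (rowList F i).count b.val =
      ((Finset.range (ν.rowLen 0)).filter (fun j => uval F i j = some b.val)).card :=
    fun F i => count_rowList _ _
  have hm0' : (rowList T 0).count b.val = (rowList T₁ 0).count b.val + t 0 := by
    rw [hcount, hcount]; convert hm0
  have hm' : ∀ i, (rowList T (i + 1)).count b.val + t i =
      (rowList T₁ (i + 1)).count b.val + t (i + 1) := by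
    intro i
    rw [hcount, hcount]; convert hm i
  have key := descProd_transfer (y := g b) (m := fun i => (rowList T i).count b.val)
    (m' := fun i => (rowList T₁ i).count b.val)
    (A := fun i => (((rowList T i).filter (· < b.val)).map g).prod)
    (C := fun i => (((rowList T i).filter (b.val < ·)).map g).prod) ht hm0' hm' (by
      intro i hi
      obtain ⟨l, ⟨h1, h1'⟩, ⟨h2, h2'⟩⟩ := hlink i hi
      -- Where the ribbon joins the two rows, the lower box is `ā` before conversion and the upper
      -- box is `ā` after it.
      have hlow : T ⟨_, h2⟩ = .barred a := hT.col_lower h1' h2' h.1 rfl (Nat.lt_succ_self i)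
      have hupp : T₁ ⟨_, h1⟩ = .barred a := by
        rw [← hR.ribbon_eq] at h1' h2'
        exact hT'.col_upper h1' h2' h.2.1 rfl (Nat.lt_succ_self i)
      apply hg.transfer ((rowList_pairwise hT i).filter _) ((rowList_pairwise hT (i + 1)).filter _)
        (by simp) (by simp)
      -- For `b = 0` the index `b - 1` is truncated to `b`, but the list of smaller letters is
      -- empty.
      · rcases Nat.eq_zero_or_pos b.val with hb0 | hb0
        · simp [hb0]
        refine (List.Sublist.count_le _ List.filter_sublist).trans (count_rowList_le ?_)
        -- Each `b - 1` in row `i` lies left of column `l` and has a `b` below it: otherwise the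
        -- letter below would lie strictly between `b - 1` and `b`, hence be barred, against
        -- `hclear.below`.
        intro j hj
        obtain ⟨hm, x, hx, hxb⟩ := uval_eq_some.mp hj
        have hxb' : x.val + 1 = b.val := by omega
        have hlt : o.lt (.unbarred x) (.unbarred b) := o.unbarred_lt _ _ (Fin.lt_def.mpr (by omega))
        have hlt' := h.1
        have hjl : j < l := by
          by_contra hn
          have hle := hT.row_le (c := ⟨_, h1⟩) (d := ⟨_, hm⟩) rfl (not_lt.mp hn)
          rw [hx] at hle
          rw [o.lt_iff] at hlt hlt'
          rcases h1' with h1' | h1' <;> rw [h1'] at hle <;> omega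
        have hm2 : (i + 1, j) ∈ ν := ν.up_left_mem le_rfl hjl.le h2
        refine uval_eq_some_val.mpr ⟨hm2, ?_⟩
        by_contra hne
        have q1 := hT.col_weak ⟨_, hm⟩ ⟨_, hm2⟩ rfl (Nat.lt_succ_self i)
        have q2 := hT.col_strict ⟨_, hm⟩ ⟨_, hm2⟩ rfl (Nat.lt_succ_self i)
        have q3 := hT.row_weak ⟨_, hm2⟩ ⟨_, h2⟩ rfl hjl
        have q4 := hT.row_strict ⟨_, hm2⟩ ⟨_, h2⟩ rfl hjl
        rw [hx] at q1 q2
        rw [hlow] at q3 q4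
        have q1 := q1.resolve_left (q2 rfl)
        have hne' : T ⟨_, hm2⟩ ≠ .barred a := fun hq => q4 (by rw [hq]; rfl) hq
        have q3 := (hs _ hne hne').mpr (q3.resolve_left hne')
        rcases hV : T ⟨_, hm2⟩ with y | y
        · rw [hV, o.unbarred_lt_iff, Fin.lt_def] at q1 q3
          omega
        · rw [hV] at q1 q3
          exact hclear.below x y hxb' q1 q3
      · refine (List.Sublist.count_le _ List.filter_sublist).trans (count_rowList_le ?_)
        -- Each `b + 1` in row `i + 1` lies right of column `l` and after conversion has a `b` above
        -- it: otherwise a barred letter would lie strictly between `b` and `b + 1` for `o'`.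
        intro j hj
        obtain ⟨hm, z, hz, hzb⟩ := uval_eq_some.mp hj
        have hzne : Letter.unbarred z ≠ .unbarred b := by rintro ⟨⟩; omega
        have hzR : (⟨_, hm⟩ : ν) ∉ ribbon T b a := by
          rintro (hq | hq) <;> rw [hz] at hq
          · exact hzne hq
          · cases hq
        have hbz : o.lt (.unbarred b) (.unbarred z) := o.unbarred_lt _ _ (Fin.lt_def.mpr (by omega))
        have hjl : l < j := by
          by_contra hn
          have hle := hT.row_le (c := ⟨_, hm⟩) (d := ⟨_, h2⟩) rfl (not_lt.mp hn)
          rw [hz, hlow] at hle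
          have hss := hs (.unbarred z) hzne (by simp)
          have hne := o.rank_ne (show Letter.unbarred z ≠ .barred a by simp)
          rw [o.lt_iff] at hbz
          rw [o.lt_iff, o.lt_iff] at hss
          omega
        have hm2 : (i, j) ∈ ν := ν.up_left_mem (Nat.le_succ i) le_rfl hm
        refine uval_eq_some_val.mpr ⟨hm2, ?_⟩
        by_contra hne
        have q1 := hT'.row_weak ⟨_, h1⟩ ⟨_, hm2⟩ rfl hjl
        have q2 := hT'.row_strict ⟨_, h1⟩ ⟨_, hm2⟩ rfl hjl
        have q3 := hT'.col_weak ⟨_, hm2⟩ ⟨_, hm⟩ rfl (Nat.lt_succ_self i)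
        have q4 := hT'.col_strict ⟨_, hm2⟩ ⟨_, hm⟩ rfl (Nat.lt_succ_self i)
        rw [hupp] at q1 q2
        rw [hR.1 _ hzR, hz] at q3 q4
        have q1 := q1.resolve_left (q2 rfl)
        have q3 := q3.resolve_left fun hq => q4 (by rw [hq]; rfl) hq
        have hne' : T₁ ⟨_, hm2⟩ ≠ .barred a := fun hq => by
          rw [hq] at q1; exact o'.irrefl _ q1
        have q5 : o'.lt (.unbarred b) (T₁ ⟨_, hm2⟩) := by
          refine (o'.lt_or_lt hne).resolve_left fun hq => ?_
          exact o'.asymm ((hs' _ hne hne').mp hq) q1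
        rcases hV : T₁ ⟨_, hm2⟩ with y | y
        · rw [hV, o'.unbarred_lt_iff, Fin.lt_def] at q5 q3
          omega
        · rw [hV] at q5 q3
          exact hclear.above z y (by omega) q5 q3) (ν.colLen 0)
  have hF : ∀ i, (((rowList T i).filter (· < b.val)).map g).prod *
      g b ^ (rowList T i).count b.val * (((rowList T i).filter (b.val < ·)).map g).prod =
      ((rowList T i).map g).prod := fun i => (prod_rowList g (rowList_pairwise hT i) b).symm
  have hF' : ∀ i, (((rowList T i).filter (· < b.val)).map g).prod *
      g b ^ (rowList T₁ i).count b.val * (((rowList T i).filter (b.val < ·)).map g).prod =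
      ((rowList T₁ i).map g).prod := fun i => by
    rw [filter_rowList_eq hR i _ (by simp), filter_rowList_eq hR i _ (by simp)]
    exact (prod_rowList g (rowList_pairwise hT' i) b).symm
  -- No surplus is left at the end: the row with index `ν.colLen 0` is the first empty one, so
  -- nothing links to it from there on.
  have ht0 : t (ν.colLen 0) = 0 := by
    by_contra hn
    obtain ⟨l, ⟨h1, _⟩, _⟩ := hlink (ν.colLen 0) (by have := ht (ν.colLen 0); omega)
    exact lt_irrefl _ (lt_colLen_zero h1)
  have hempty : ∀ F : Filling N ν, rowList F (ν.colLen 0) = [] := by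
    intro F
    rw [rowList, List.filterMap_eq_nil_iff]
    intro j _
    rw [uval, dif_neg]
    exact fun h1 => lt_irrefl _ (lt_colLen_zero h1)
  simp only [ht0, add_zero, hF, hF'] at key
  rw [descProd_succ] at key
  simpa [hempty] using key

end ColoredTableaux

/-! ### From diagonal reading to row reading -/

namespace ColoredTableaux
open Relation

variable {N : ℕ} {ν : YoungDiagram} {o o' : ShuffleOrder N} {b a : Fin N} {T T' : Filling N ν}

/-! ### Diagonals as lists of rows -/

theorem filterMap_range_eq_toList {α : Type*} (f : ℕ → Option α) (m j₀ : ℕ)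
    (h : ∀ j, j ≠ j₀ → f j = none) (hm : m ≤ j₀ → f j₀ = none) :
    (List.range m).filterMap f = (f j₀).toList := by
  induction m with
  | zero => simp [hm (Nat.zero_le _)]
  | succ m ih =>
    rw [List.range_succ, List.filterMap_append]
    by_cases hj : m = j₀
    · subst hj
      have : (List.range m).filterMap f = [] := by
        rw [List.filterMap_eq_nil_iff]
        intro j hj
        exact h j (List.mem_range.mp hj).ne
      rw [this]
      rcases hf : f m with _ | y <;> simp [hf]
    · rw [ih fun hle => hm (by omega)]
      simp [h m hj]

/-- A row meets a diagonal in at most one box. The inequality guards against truncated subtraction.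
-/
theorem diagonal_eq (ν : YoungDiagram) (k : ℕ) :
    diagonal ν k = (List.range (ν.colLen 0)).filterMap fun i =>
      if h : (i, i + k - ν.colLen 0) ∈ ν ∧ ν.colLen 0 ≤ i + k then
        some ⟨(i, i + k - ν.colLen 0), h.1⟩ else none := by
  rw [diagonal, List.filterMap_eq_flatMap_toList (l := List.range (ν.colLen 0))]
  change List.filterMap _ (List.flatMap _ _) = _
  rw [List.filterMap_flatMap]
  refine List.flatMap_congr fun i _ => ?_
  rw [List.filterMap_map, filterMap_range_eq_toList _ _ (i + k - ν.colLen 0)]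
  · congr 1
    simp only [Function.comp_apply]
    refine dite_congr (propext (and_congr_right fun _ => by omega)) (fun _ => rfl) (fun _ => rfl)
  · intro j hj
    simp only [Function.comp_apply]
    rw [dif_neg]
    rintro ⟨_, h⟩
    omega
  · intro hm
    simp only [Function.comp_apply]
    rw [dif_neg]
    rintro ⟨h, _⟩
    exact absurd (lt_rowLen_zero h) (not_lt.mpr hm)

theorem mem_diagonal {k : ℕ} {c : ν} :
    c ∈ diagonal ν k ↔ c.1.2 + ν.colLen 0 = c.1.1 + k := by
  rw [diagonal_eq, List.mem_filterMap]
  constructor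
  · rintro ⟨i, _, h⟩
    split_ifs at h with h'
    cases h
    simp only
    omega
  · intro h
    refine ⟨c.1.1, List.mem_range.mpr (lt_colLen_zero c.2), ?_⟩
    have e : (c.1.1, c.1.1 + k - ν.colLen 0) = c.1 := Prod.ext rfl (by simp only; omega)
    rw [dif_pos ⟨by rw [e]; exact c.2, by omega⟩]
    exact congrArg some (Subtype.ext e)

theorem diagonal_pairwise (ν : YoungDiagram) (k : ℕ) :
    (diagonal ν k).Pairwise fun c d => c.1.1 < d.1.1 := by
  rw [diagonal_eq, List.pairwise_filterMap]
  refine List.Pairwise.imp ?_ List.pairwise_lt_range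
  intro i j hij x hx y hy
  split_ifs at hx hy
  cases hx
  cases hy
  exact hij

/-! ### Products of letters along diagonals and along rows -/

section Products
variable {M : Type*} [Monoid M] (g : ℕ → M)

/-- The value of an unbarred letter; barred letters are ignored. -/
def Letter.val (x : Letter N) : M := x.unbarred?.elim 1 g

/-- The value of the unbarred letter in a box, if there is one. -/
def boxVal (T : Filling N ν) (i j : ℕ) : M := (uval T i j).elim 1 g

/-- The value of the unbarred letter in row `i` on the `k`-th diagonal, if there is one. -/
def diagVal (T : Filling N ν) (i k : ℕ) : M :=
  if ν.colLen 0 ≤ i + k then boxVal g T i (i + k - ν.colLen 0) else 1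

theorem prod_map_filterMap {α β : Type*} (f : α → Option β) (h : β → M) (l : List α) :
    ((l.filterMap f).map h).prod = (l.map fun x => (f x).elim 1 h).prod := by
  induction l with
  | nil => rfl
  | cons x l ih =>
    rcases hf : f x with _ | y <;> simp [hf, ih]

theorem prod_map_flatMap {α β : Type*} (f : α → List β) (h : β → M) (l : List α) :
    ((l.flatMap f).map h).prod = (l.map fun x => ((f x).map h).prod).prod := by
  induction l with
  | nil => rfl
  | cons x l ih => simp [ih]

theorem prod_map_filter {α : Type*} (p : α → Bool) (h : α → M) (l : List α)
    (hp : ∀ x ∈ l, p x = false → h x = 1) :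
    ((l.filter p).map h).prod = (l.map h).prod := by
  induction l with
  | nil => rfl
  | cons x l ih =>
    have ih := ih fun y hy => hp y (by simp [hy])
    rcases hx : p x with _ | _
    · simp [hx, ih, hp x (by simp) hx]
    · simp [hx, ih]

theorem prod_map_eq_one {α : Type*} (h : α → M) (l : List α) (hl : ∀ x ∈ l, h x = 1) :
    (l.map h).prod = 1 := by
  induction l with
  | nil => rfl
  | cons x l ih => simp [hl x (by simp), ih fun y hy => hl y (by simp [hy])]

theorem prod_diagonalWord (T : Filling N ν) (k : ℕ) :
    ((diagonalWord T k).map (Letter.val g)).prod =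
      (((diagonal ν k).reverse.map T).map (Letter.val g)).prod := by
  rw [diagonalWord, List.map_append, List.prod_append, prod_map_filter,
    prod_map_eq_one (l := List.filter (fun x : Letter N => x.isBarred) (List.map T (diagonal ν k))), mul_one]
  · intro x hx
    rw [List.mem_filter] at hx
    rcases x with x | x
    · simp [Letter.isBarred] at hx
    · rfl
  · rintro (x | x) _ hx
    · simp [Letter.isBarred] at hx
    · rfl

theorem prod_diagonalWord_eq (T : Filling N ν) (k : ℕ) :
    ((diagonalWord T k).map (Letter.val g)).prod =
      ((List.range' 0 (ν.colLen 0)).reverse.map fun i => diagVal g T i k).prod := by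
  rw [prod_diagonalWord, diagonal_eq, ← List.filterMap_reverse, List.map_map, prod_map_filterMap,
    List.range_eq_range']
  congr 1
  refine List.map_congr_left fun i _ => ?_
  unfold diagVal boxVal uval
  by_cases h1 : ν.colLen 0 ≤ i + k <;> by_cases h2 : (i, i + k - ν.colLen 0) ∈ ν <;>
    simp [h1, h2, Letter.val]

/-- The first `ν.colLen 0 - i` diagonals meet row `i` left of its first column, and the last `i` of
them beyond the width of `ν`; the remaining ones run through its columns. -/
theorem prod_range_diagVal (T : Filling N ν) {i : ℕ} (hi : i < ν.colLen 0) :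
    ((List.range (ν.colLen 0 + ν.rowLen 0)).map (diagVal g T i)).prod =
      ((rowList T i).map g).prod := by
  have h1 : ν.colLen 0 + ν.rowLen 0 = (ν.colLen 0 - i) + (ν.rowLen 0 + i) := by omega
  rw [h1, List.range_add, List.map_append, List.prod_append, prod_map_eq_one, one_mul,
    List.range_add, List.map_append, List.map_append, List.prod_append, rowList,
    prod_map_filterMap]
  · rw [prod_map_eq_one (l := List.map _ (List.map _ (List.range i))), mul_one, List.map_map]
    · congr 1
      refine List.map_congr_left fun j _ => ?_
      simp only [Function.comp_apply, diagVal]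
      rw [if_pos (by omega), show i + (ν.colLen 0 - i + j) - ν.colLen 0 = j by omega]
      rfl
    · intro x hx
      simp only [List.map_map, List.mem_map, Function.comp_apply] at hx
      obtain ⟨j, _, rfl⟩ := hx
      unfold diagVal
      split_ifs
      · unfold boxVal uval
        rw [dif_neg]
        · rfl
        · intro h
          have := lt_rowLen_zero h
          omega
      · rfl
  · intro k hk
    rw [List.mem_range] at hk
    rw [diagVal, if_neg (by omega)]

/-- Suppose `y = x + 1`. If the box right of `x` did not contain `x`, it and the next box in its row
would hold distinct barred letters between `x` and `x + 1`, which sparseness forbids. If `y` were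
lower than the next row, two adjacent boxes of row `r + 1` would give the same contradiction. -/
theorem sparse_of_diagonal (hT : IsColored o T) (ho : SparseBarred o) {r j i' j' : ℕ} {x y : Fin N}
    (hc : (r, j) ∈ ν) (hd : (i', j') ∈ ν) (hx : T ⟨_, hc⟩ = .unbarred x)
    (hy : T ⟨_, hd⟩ = .unbarred y) (hr : r < i') (hdiag : j + i' < j' + r) :
    x.val + 2 ≤ y.val ∨ (y.val = x.val + 1 ∧ i' = r + 1 ∧
      ∃ h : (r, j + 1) ∈ ν, T ⟨_, h⟩ = .unbarred x) := by
  have mem : ∀ p q, p ≤ i' → q ≤ j' → (p, q) ∈ ν := fun p q h1 h2 => ν.up_left_mem h1 h2 hd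
  have hcol : ∀ p (h1 : p < i') (h : (p, j') ∈ ν), o.lt (T ⟨_, h⟩) (.unbarred y) := by
    intro p h1 h
    have q1 := hT.col_weak ⟨_, h⟩ ⟨_, hd⟩ rfl h1
    have q2 := hT.col_strict ⟨_, h⟩ ⟨_, hd⟩ rfl h1
    rw [hy] at q1 q2
    exact q1.resolve_left fun hq => q2 (by rw [hq]; rfl) hq
  have hlt : ∀ p q, p < i' → q ≤ j' → ∀ h : (p, q) ∈ ν, o.rank (T ⟨_, h⟩) < o.rank (.unbarred y) := by
    intro p q h1 h2 h
    have hm := mem p j' h1.le le_rfl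
    exact (hT.row_le (c := ⟨_, h⟩) (d := ⟨_, hm⟩) rfl h2).trans_lt (o.rank_lt (hcol p h1 hm))
  have hxy := hlt r j hr (by omega) hc
  rw [hx, ← o.lt_iff, o.unbarred_lt_iff, Fin.lt_def] at hxy
  by_cases hy2 : x.val + 2 ≤ y.val
  · exact Or.inl hy2
  have hyx : x.val + 1 = y.val := by omega
  have h1 := mem r (j + 1) hr.le (by omega)
  have hnext : T ⟨_, h1⟩ = .unbarred x := by
    by_contra hne
    have q1 := hT.row_weak ⟨_, hc⟩ ⟨_, h1⟩ rfl (Nat.lt_succ_self j)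
    rw [hx] at q1
    have q1 := q1.resolve_left (Ne.symm hne)
    have q2 := hlt r (j + 1) hr (by omega) h1
    rw [← o.lt_iff] at q2
    rcases hV : T ⟨_, h1⟩ with v | v <;> rw [hV] at q1 q2
    · rw [o.unbarred_lt_iff, Fin.lt_def] at q1 q2
      omega
    have h2 := mem r (j + 2) hr.le (by omega)
    have q3 := hT.row_weak ⟨_, h1⟩ ⟨_, h2⟩ rfl (Nat.lt_succ_self (j + 1))
    have q4 := hT.row_strict ⟨_, h1⟩ ⟨_, h2⟩ rfl (Nat.lt_succ_self (j + 1)) (by rw [hV]; rfl)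
    have q5 := hlt r (j + 2) hr (by omega) h2
    have q3 := q3.resolve_left q4
    rw [hV] at q3 q4
    rw [← o.lt_iff] at q5
    have q6 := o.trans q1 q3
    rcases hW : T ⟨_, h2⟩ with w | w <;> rw [hW] at q3 q4 q5 q6
    · rw [o.unbarred_lt_iff, Fin.lt_def] at q5 q6
      omega
    · exact q4 (congrArg _ (ho x y v w hyx q1 q2 q6 q5))
  refine Or.inr ⟨by omega, ?_, h1, hnext⟩
  by_contra hi
  have hi2 : r + 1 < i' := by omega
  have h2 := mem (r + 1) (j + 1) (by omega) (by omega)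
  have h3 := mem (r + 1) (j + 2) (by omega) (by omega)
  have q1 := hT.col_weak ⟨_, h1⟩ ⟨_, h2⟩ rfl (Nat.lt_succ_self r)
  have q2 := hT.col_strict ⟨_, h1⟩ ⟨_, h2⟩ rfl (Nat.lt_succ_self r)
  rw [hnext] at q1 q2
  have q1 := q1.resolve_left (q2 rfl)
  have q3 := hlt (r + 1) (j + 1) hi2 (by omega) h2
  rw [← o.lt_iff] at q3
  rcases hV : T ⟨_, h2⟩ with v | v <;> rw [hV] at q1 q3
  · rw [o.unbarred_lt_iff, Fin.lt_def] at q1 q3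
    omega
  have q4 := hT.row_weak ⟨_, h2⟩ ⟨_, h3⟩ rfl (Nat.lt_succ_self (j + 1))
  have q5 := hT.row_strict ⟨_, h2⟩ ⟨_, h3⟩ rfl (Nat.lt_succ_self (j + 1)) (by rw [hV]; rfl)
  have q6 := hlt (r + 1) (j + 2) hi2 (by omega) h3
  have q4 := q4.resolve_left q5
  rw [hV] at q4 q5
  rw [← o.lt_iff] at q6
  have q7 := o.trans q1 q4
  rcases hW : T ⟨_, h3⟩ with w | w <;> rw [hW] at q4 q5 q6 q7
  · rw [o.unbarred_lt_iff, Fin.lt_def] at q6 q7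
    omega
  · exact q5 (congrArg _ (ho x y v w hyx q1 q3 q7 q6))

variable {g}

theorem diagVal_cases (g : ℕ → M) (T : Filling N ν) (i k : ℕ) :
    diagVal g T i k = 1 ∨ ∃ j, j + ν.colLen 0 = i + k ∧ ∃ h : (i, j) ∈ ν, ∃ x : Fin N,
      T ⟨_, h⟩ = .unbarred x ∧ diagVal g T i k = g x.val := by
  unfold diagVal
  split_ifs with h1
  · rcases h : uval T i (i + k - ν.colLen 0) with _ | x
    · left; simp [boxVal, h]
    · right
      obtain ⟨h2, x, hx, rfl⟩ := uval_eq_some.mp h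
      exact ⟨_, by omega, h2, x, hx, by simp [boxVal, h]⟩
  · exact Or.inl rfl

/-- Letters in lower rows on later diagonals commute with the letter `x` on diagonal `d`, with one
possible exception: an `x + 1` in the next row. In that case the letter after `x` in its row is
again `x`, and `zyy` gives the exchange. -/
theorem diagVal_mul_prod_mul (hg : LocalPlactic g) (hT : IsColored o T) (ho : SparseBarred o)
    (r n d k : ℕ) (hdk : d < k) :
    diagVal g T r d * ((List.range' (r + 1) n).reverse.map fun i => diagVal g T i k).prod *
        diagVal g T r (d + 1) =
      ((List.range' (r + 1) n).reverse.map fun i => diagVal g T i k).prod * diagVal g T r d *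
        diagVal g T r (d + 1) := by
  rcases diagVal_cases g T r d with h | ⟨j, hj, hc, x, hx, h⟩
  · simp [h]
  rw [h]
  cases n with
  | zero => simp
  | succ n =>
    rw [List.range'_succ, List.reverse_cons, List.map_append, List.prod_append]
    simp only [List.map_cons, List.map_nil, List.prod_cons, List.prod_nil, mul_one]
    set E := ((List.range' (r + 1 + 1) n).reverse.map fun i => diagVal g T i k).prod with hE
    have hcE : Commute E (g x.val) := by
      apply commute_prod
      intro y hy
      simp only [List.mem_map, List.mem_reverse, List.mem_range'_1] at hy
      obtain ⟨i', hi', rfl⟩ := hy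
      rcases diagVal_cases g T i' k with h' | ⟨j', hj', hd, y, hy, h'⟩
      · rw [h']; exact Commute.one_left _
      · rw [h']
        rcases sparse_of_diagonal hT ho hc hd hx hy (by omega) (by omega) with h2 | ⟨_, h2, _⟩
        · exact hg.commute (Or.inr h2)
        · omega
    rcases diagVal_cases g T (r + 1) k with h' | ⟨j', hj', hd, y, hy, h'⟩
    · rw [h', mul_one, hcE.eq]
    · rw [h']
      rcases sparse_of_diagonal hT ho hc hd hx hy (by omega) (by omega) with h2 | ⟨h2, _, h3, h4⟩
      · rw [← mul_assoc, ← hcE.eq, mul_assoc E, (hg.commute (Or.inl h2)).eq]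
        simp only [mul_assoc]
      · have : diagVal g T r (d + 1) = g x.val := by
          rw [diagVal, if_pos (by omega), show r + (d + 1) - ν.colLen 0 = j + 1 by omega, boxVal,
            uval_eq_some_val.mpr ⟨h3, h4⟩]
          rfl
        rw [this, h2]
        have hz := hg.zyy x.val
        calc _ = (g x.val * E) * g (x.val + 1) * g x.val := by simp only [mul_assoc]
          _ = E * (g x.val * g (x.val + 1) * g x.val) := by
              rw [← hcE.eq]; simp only [mul_assoc]
          _ = _ := by rw [← hz]; simp only [mul_assoc]

/-- Up to local plactic equivalence, the unbarred letters may be read row by row. -/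
theorem prod_sqread_eq_descProd (hg : LocalPlactic g) (hT : IsColored o T) (ho : SparseBarred o) :
    ((sqread T).map (Letter.val g)).prod =
      descProd (fun i => ((rowList T i).map g).prod) (ν.colLen 0) := by
  -- The top remaining row `r` is split off to the right; the lower rows are handled by induction.
  have key : ∀ n r, r + n = ν.colLen 0 →
      ((List.range (ν.colLen 0 + ν.rowLen 0)).map fun k =>
        ((List.range' r n).reverse.map fun i => diagVal g T i k).prod).prod =
      ((List.range' r n).reverse.map fun i => ((rowList T i).map g).prod).prod := by
    intro n
    induction n with
    | zero => intro r _; simp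
    | succ n ih =>
      intro r hr
      simp only [List.range'_succ, List.reverse_cons, List.map_append, List.prod_append,
        List.map_cons, List.map_nil, List.prod_cons, List.prod_nil, mul_one]
      rw [prod_mul_eq_prod_mul_prod _ _ _ fun d k hdk _ => diagVal_mul_prod_mul hg hT ho r n d k hdk,
        ih (r + 1) (by omega), prod_range_diagVal g T (by omega)]
  rw [sqread, prod_map_flatMap, descProd, List.range_eq_range' (n := ν.colLen 0),
    ← key _ 0 (by omega)]
  congr 1
  exact List.map_congr_left fun k _ => prod_diagonalWord_eq g T k

/-- The unbarred part of the reading word is invariant, up to local plactic equivalence, under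
sequences of clear swaps. -/
theorem prod_sqread_eq (hg : LocalPlactic g)
    (h : ReflTransGen (fun p q : ShuffleOrder N × Filling N ν =>
      DownStep p q ∧ ClearSwap p.1 q.1) (o, T) (o', T'))
    (hT : IsColored o T) (hT' : IsColored o' T') (ho : SparseBarred o) (ho' : SparseBarred o') :
    ((sqread T).map (Letter.val g)).prod = ((sqread T').map (Letter.val g)).prod := by
  rw [prod_sqread_eq_descProd hg hT ho, prod_sqread_eq_descProd hg hT' ho']
  have key : ∀ p q : ShuffleOrder N × Filling N ν,
      ReflTransGen (fun p q => DownStep p q ∧ ClearSwap p.1 q.1) p q →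
      descProd (fun i => ((rowList p.2 i).map g).prod) (ν.colLen 0) =
        descProd (fun i => ((rowList q.2 i).map g).prod) (ν.colLen 0) := by
    intro p q h
    induction h with
    | refl => rfl
    | tail _ hs ih =>
      rw [ih]
      obtain ⟨⟨b, a, h1, h2, h3, h4⟩, b', a', h1', h5⟩ := hs
      -- The step and the clear swap name their pairs separately, but a swap of orders reverses only
      -- one pair.
      obtain rfl : b = b' := by
        by_contra hne
        exact absurd h1.2.1 (ShuffleOrder.asymm _ ((h1'.2.2 _ _ (by simp [hne]) (by simp)).mp h1.1))
      exact descProd_rowList_eq hg h1 h5 h2 h3 h4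
  exact key _ _ h

end Products
end ColoredTableaux

/-! ### The barred letters, by transposition -/

namespace ColoredTableaux
open Relation MulOpposite

variable {N : ℕ} {ν : YoungDiagram} {o o' : ShuffleOrder N} {b a : Fin N} {T T' : Filling N ν}

/-! ### Transposition -/

/-- Exchange barred and unbarred letters. -/
def Letter.flip : Letter N → Letter N
  | .unbarred a => .barred a
  | .barred a => .unbarred a

@[simp] theorem Letter.flip_flip (x : Letter N) : x.flip.flip = x := by cases x <;> rfl

@[simp] theorem Letter.isBarred_flip (x : Letter N) : x.flip.isBarred = !x.isBarred := by
  cases x <;> rfl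

theorem Letter.flip_injective : Function.Injective (Letter.flip (N := N)) :=
  Function.LeftInverse.injective Letter.flip_flip

/-- The order obtained by exchanging barred and unbarred letters. -/
def ShuffleOrder.flip (o : ShuffleOrder N) : ShuffleOrder N where
  lt x y := o.lt x.flip y.flip
  total :=
    { trichotomous := fun _ _ h h' => Letter.flip_injective (o.total.trichotomous _ _ h h')
      irrefl := fun _ => o.irrefl _
      trans := fun _ _ _ h h' => o.trans h h' }
  unbarred_lt a b h := o.barred_lt a b h
  barred_lt a b h := o.unbarred_lt a b h

/-- Exchanging the two kinds of letters exchanges which of the pair is the barred one, so a downward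
swap becomes an upward one and the two orders trade places. -/
theorem DifferBySwap.flip (h : DifferBySwap o o' b a) : DifferBySwap o'.flip o.flip a b := by
  refine ⟨h.2.1, h.1, fun x y h1 h2 => (h.2.2 x.flip y.flip ?_ ?_).symm⟩
  · rintro ⟨h3, h4⟩
    exact h2 ⟨by rw [← x.flip_flip, h3]; rfl, by rw [← y.flip_flip, h4]; rfl⟩
  · rintro ⟨h3, h4⟩
    exact h1 ⟨by rw [← x.flip_flip, h3]; rfl, by rw [← y.flip_flip, h4]; rfl⟩

/-- The transposition of boxes. -/
def transposeBox (ν : YoungDiagram) : ν.transpose ≃ ν where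
  toFun c := ⟨c.1.swap, YoungDiagram.mem_transpose.mp c.2⟩
  invFun c := ⟨c.1.swap, YoungDiagram.mem_transpose.mpr (by rw [Prod.swap_swap]; exact c.2)⟩
  left_inv _ := rfl
  right_inv _ := rfl

/-- The transpose of a filling, with barred and unbarred letters exchanged. -/
def transposeFilling (T : Filling N ν) : Filling N ν.transpose := fun c => (T (transposeBox ν c)).flip

theorem IsColored.transpose (hT : IsColored o T) : IsColored o.flip (transposeFilling T) := by
  have weak : ∀ x y : Letter N, (x = y ∨ o.lt x y) → x.flip = y.flip ∨ o.flip.lt x.flip y.flip := by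
    intro x y h
    simpa only [ShuffleOrder.flip, Letter.flip_flip, Letter.flip_injective.eq_iff] using h
  constructor
  · intro c c' h1 h2
    exact weak _ _ (hT.col_weak (transposeBox ν c) (transposeBox ν c') h1 h2)
  · intro c c' h1 h2
    exact weak _ _ (hT.row_weak (transposeBox ν c) (transposeBox ν c') h1 h2)
  · intro c c' h1 h2 h3
    refine Letter.flip_injective.ne (hT.col_strict (transposeBox ν c) (transposeBox ν c') h1 h2 ?_)
    simpa [transposeFilling] using h3
  · intro c c' h1 h2 h3
    refine Letter.flip_injective.ne (hT.row_strict (transposeBox ν c) (transposeBox ν c') h1 h2 ?_)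
    simpa [transposeFilling] using h3

theorem transposeFilling_eq_unbarred {c : ν.transpose} :
    transposeFilling T c = .unbarred a ↔ T (transposeBox ν c) = .barred a :=
  Letter.flip_injective.eq_iff (b := .barred a)

theorem transposeFilling_eq_barred {c : ν.transpose} :
    transposeFilling T c = .barred b ↔ T (transposeBox ν c) = .unbarred b :=
  Letter.flip_injective.eq_iff (b := .unbarred b)

theorem ribbon_transpose :
    ribbon (transposeFilling T) a b = transposeBox ν ⁻¹' ribbon T b a := by
  ext c
  simp only [ribbon, Set.mem_preimage, Set.mem_ofPred_eq, transposeFilling_eq_unbarred,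
    transposeFilling_eq_barred]
  exact or_comm

theorem mem_component_transpose {R : Set ν} {c d : ν.transpose} :
    d ∈ component (transposeBox ν ⁻¹' R) c ↔ transposeBox ν d ∈ component R (transposeBox ν c) := by
  constructor
  · intro h
    refine ReflTransGen.lift (transposeBox ν) ?_ _ _ h
    rintro x y ⟨h1, h2, h3⟩
    exact ⟨h1, h2, h3.symm⟩
  · intro h
    have := ReflTransGen.lift (p := fun d d' : ν.transpose => d ∈ transposeBox ν ⁻¹' R ∧
      d' ∈ transposeBox ν ⁻¹' R ∧ BoxAdj d.1 d'.1) (transposeBox ν).symm ?_ _ _ h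
    · simp only [Function.onFun, Equiv.symm_apply_apply] at this
      exact this
    · rintro x y ⟨h1, h2, h3⟩
      exact ⟨by simpa using h1, by simpa using h2, h3.symm⟩

theorem Refills.transpose (h : Refills b a T T') :
    Refills a b (transposeFilling T) (transposeFilling T') := by
  have hcard : ∀ s : Set ν, (transposeBox ν ⁻¹' s).ncard = s.ncard := fun s => by
    rw [← Set.ncard_image_of_injective _ (transposeBox ν).injective,
      Set.image_preimage_eq _ (transposeBox ν).surjective]
  have key : ∀ (F : Filling N ν) (R : Set ν) (x : Letter N) (c : ν.transpose),
      {d ∈ component (transposeBox ν ⁻¹' R) c | transposeFilling F d = x.flip}.ncard =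
        {d ∈ component R (transposeBox ν c) | F d = x}.ncard := by
    intro F R x c
    rw [← hcard]
    congr 1
    ext d
    exact and_congr mem_component_transpose Letter.flip_injective.eq_iff
  refine ⟨fun c hc => ?_, fun c hc => ?_⟩
  · rw [ribbon_transpose] at hc
    exact congrArg Letter.flip (h.1 _ hc)
  · rw [ribbon_transpose] at hc ⊢
    have h' := h.2 _ hc
    refine ⟨?_, ?_⟩
    · exact (key T' _ (.barred a) c).trans (h'.2.trans (key T _ (.barred a) c).symm)
    · exact (key T' _ (.unbarred b) c).trans (h'.1.trans (key T _ (.unbarred b) c).symm)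

theorem clearSteps_transpose {p q : ShuffleOrder N × Filling N ν}
    (h : ReflTransGen (fun p q => DownStep p q ∧ ClearSwapBarred p.1 q.1) p q) :
    ReflTransGen (fun p q => DownStep p q ∧ ClearSwap p.1 q.1)
      (q.1.flip, transposeFilling q.2) (p.1.flip, transposeFilling p.2) := by
  induction h with
  | refl => exact .refl
  | tail _ hs ih =>
    obtain ⟨⟨b, a, h1, h2, h3, h4⟩, b', a', h5, h6⟩ := hs
    exact .head ⟨⟨a, b, h1.flip, h3.transpose, h2.transpose, h4.symm.transpose⟩,
      a', b', h5.flip, h6.below, h6.above⟩ ih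

/-- Transposition reverses the sequence of diagonals but keeps the direction from northwest to
southeast within each. -/
theorem map_diagonal_transpose (ν : YoungDiagram) {k : ℕ} (hk : k ≤ ν.colLen 0 + ν.rowLen 0) :
    (diagonal ν.transpose k).map (transposeBox ν) = diagonal ν (ν.colLen 0 + ν.rowLen 0 - k) := by
  let r : ν → ν → Prop := fun c d => c.1.1 < d.1.1
  have : Std.Irrefl r := ⟨fun c => lt_irrefl _⟩
  have : Std.Antisymm r := ⟨fun c d h h' => absurd h' (lt_asymm h)⟩
  refine List.Pairwise.eq_of_mem_iff (r := r) ?_ (diagonal_pairwise ν _) ?_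
  · rw [List.pairwise_map]
    refine (diagonal_pairwise ν.transpose k).imp_of_mem ?_
    intro c d hc hd h
    rw [mem_diagonal] at hc hd
    change c.1.2 < d.1.2
    omega
  · intro c
    rw [mem_diagonal, List.mem_map]
    constructor
    · rintro ⟨d, hd, rfl⟩
      rw [mem_diagonal, YoungDiagram.colLen_transpose] at hd
      change d.1.1 + _ = d.1.2 + _
      omega
    · intro hc
      refine ⟨(transposeBox ν).symm c, ?_, by simp⟩
      rw [mem_diagonal, YoungDiagram.colLen_transpose]
      change c.1.1 + _ = c.1.2 + _
      omega

section Products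
variable {M : Type*} [Monoid M]

/-- The value of a barred letter; unbarred letters are ignored. -/
def Letter.barVal (g : ℕ → M) (x : Letter N) : M := x.flip.val g

theorem diagonal_eq_nil {k : ℕ} (h : k = 0 ∨ k = ν.colLen 0 + ν.rowLen 0) : diagonal ν k = [] := by
  rw [List.eq_nil_iff_forall_not_mem]
  intro c hc
  rw [mem_diagonal] at hc
  have h1 := lt_rowLen_zero (i := c.1.1) (j := c.1.2) c.2
  have h2 := lt_colLen_zero (i := c.1.1) (j := c.1.2) c.2
  omega

theorem prod_diagonalWord_barVal (g : ℕ → M) (T : Filling N ν) (k : ℕ) :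
    ((diagonalWord T k).map (Letter.barVal g)).prod =
      (((diagonal ν k).map T).map (Letter.barVal g)).prod := by
  rw [diagonalWord, List.map_append, List.prod_append, prod_map_eq_one, one_mul, prod_map_filter]
  · rintro (x | x) _ hx
    · rfl
    · simp [Letter.isBarred] at hx
  · intro x hx
    rw [List.mem_filter] at hx
    rcases x with x | x
    · rfl
    · simp [Letter.isBarred] at hx

/-- Barred letters are read in the opposite direction along a diagonal to unbarred ones, and
transposition reverses the sequence of diagonals. So the barred word of `T` is the reversed unbarred
word of its transpose. -/
theorem op_prod_sqread (g : ℕ → M) (T : Filling N ν) :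
    op ((sqread T).map (Letter.barVal g)).prod =
      ((sqread (transposeFilling T)).map (Letter.val fun n => op (g n))).prod := by
  set L := ν.colLen 0 + ν.rowLen 0 with hL
  let D : ℕ → Mᵐᵒᵖ := fun k =>
    ((diagonal ν k).reverse.map fun c => op ((T c).barVal g)).prod
  have hval : ∀ x : Letter N, x.flip.val (fun n => op (g n)) = op (x.barVal g) := by
    rintro (x | x) <;> rfl
  have e1 : op ((sqread T).map (Letter.barVal g)).prod = ((List.range L).reverse.map D).prod := by
    rw [sqread, prod_map_flatMap, MulOpposite.op_list_prod, List.map_map, List.map_reverse]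
    congr 2
    refine List.map_congr_left fun k _ => ?_
    simp only [Function.comp_apply, prod_diagonalWord_barVal, MulOpposite.op_list_prod, D,
      List.map_map, List.map_reverse]
    rfl
  have e2 : ((sqread (transposeFilling T)).map (Letter.val fun n => op (g n))).prod =
      ((List.range L).map fun k => D (L - k)).prod := by
    rw [sqread, prod_map_flatMap, YoungDiagram.colLen_transpose, YoungDiagram.rowLen_transpose,
      add_comm, ← hL]
    congr 1
    refine List.map_congr_left fun k hk => ?_
    rw [prod_diagonalWord]
    simp only [D, hL]
    rw [← map_diagonal_transpose ν (List.mem_range.mp hk).le, ← List.map_reverse, List.map_map,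
      List.map_map]
    congr 1
    refine List.map_congr_left fun c _ => ?_
    exact hval _
  rw [e1, e2, List.range_eq_range', List.reverse_range', ← List.range_eq_range', List.map_map]
  -- One side runs over the diagonals `L - 1, …, 0` and the other over `L, …, 1`; they agree because
  -- the diagonals `0` and `L` are empty.
  have h0 : D 0 = 1 := by simp [D, diagonal_eq_nil (ν := ν) (Or.inl rfl)]
  have hLast : D L = 1 := by simp [D, diagonal_eq_nil (ν := ν) (Or.inr hL)]
  have e3 : ((List.range (L + 1)).map fun k => D (L - k)).prod =
      ((List.range L).map fun k => D (L - k)).prod := by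
    simp [List.range_succ, h0]
  rw [← e3, List.range_succ_eq_map, List.map_cons, List.prod_cons, Nat.sub_zero, hLast, one_mul,
    List.map_map]
  congr 1
  refine List.map_congr_left fun k _ => ?_
  simp only [Function.comp_apply]
  congr 1
  omega

/-- The barred part of the reading word is invariant, up to local plactic equivalence, under
sequences of clear swaps. -/
theorem prod_sqread_barVal_eq {g : ℕ → M} (hg : LocalPlactic fun n => op (g n))
    (h : ReflTransGen (fun p q : ShuffleOrder N × Filling N ν =>
      DownStep p q ∧ ClearSwapBarred p.1 q.1) (o, T) (o', T'))
    (hT : IsColored o T) (hT' : IsColored o' T') (ho : SparseUnbarred o)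
    (ho' : SparseUnbarred o') :
    ((sqread T).map (Letter.barVal g)).prod = ((sqread T').map (Letter.barVal g)).prod := by
  apply op_injective
  rw [op_prod_sqread, op_prod_sqread]
  exact (prod_sqread_eq hg (clearSteps_transpose h) hT'.transpose hT.transpose ho' ho).symm

end Products
end ColoredTableaux

/-! ### Syntactic monoid and conclusion -/

namespace ColoredTableaux
open Relation MulOpposite

variable {N : ℕ} {ν : YoungDiagram} {W : Set (Word N)}

/-! ### The syntactic monoid of a set of words -/

/-- Two words are equivalent when they can be exchanged in all words of `W`. -/
def syntacticCon (W : Set (Word N)) : Con (FreeMonoid (Letter N)) where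
  r x y := ∀ p s : FreeMonoid (Letter N), (p * x * s).toList ∈ W ↔ (p * y * s).toList ∈ W
  iseqv := ⟨fun _ _ _ => Iff.rfl, fun h p s => (h p s).symm,
    fun h h' p s => (h p s).trans (h' p s)⟩
  mul' := by
    intro w x y z h1 h2 p s
    have e1 := h1 p (y * s)
    have e2 := h2 (p * x) s
    simp only [mul_assoc] at e1 e2 ⊢
    exact e1.trans e2

theorem syntacticCon_def {x y : FreeMonoid (Letter N)} : syntacticCon W x y ↔
    ∀ p s : FreeMonoid (Letter N), (p * x * s).toList ∈ W ↔ (p * y * s).toList ∈ W := Iff.rfl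

/-- The class of a letter in the syntactic monoid. -/
def letterClass (W : Set (Word N)) (x : Letter N) : (syntacticCon W).Quotient :=
  (FreeMonoid.of x : FreeMonoid (Letter N))

theorem prod_letterClass (w : Word N) :
    (w.map (letterClass W)).prod = ((FreeMonoid.ofList w : FreeMonoid (Letter N)) :
      (syntacticCon W).Quotient) := by
  induction w with
  | nil => rfl
  | cons x w ih => rw [List.map_cons, List.prod_cons, ih, FreeMonoid.ofList_cons]; rfl

theorem mem_iff_of_prod_letterClass_eq {w w' : Word N}
    (h : (w.map (letterClass W)).prod = (w'.map (letterClass W)).prod) : w ∈ W ↔ w' ∈ W := by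
  rw [prod_letterClass, prod_letterClass, Con.eq, syntacticCon_def] at h
  simpa using h 1 1

theorem letterClass_commute (hW : ShuffleClosed W) {x y : Letter N}
    (hxy : x.isBarred ≠ y.isBarred) : Commute (letterClass W x) (letterClass W y) := by
  change ((FreeMonoid.of x * FreeMonoid.of y : FreeMonoid (Letter N)) :
    (syntacticCon W).Quotient) = ((FreeMonoid.of y * FreeMonoid.of x : FreeMonoid (Letter N)) :
    (syntacticCon W).Quotient)
  rw [Con.eq, syntacticCon_def]
  intro p s
  exact ⟨hW p.toList s.toList x y hxy, hW p.toList s.toList y x hxy.symm⟩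

theorem pairing_of_sub_of (γ : Word N → ℤ) (x y : FreeMonoid (Letter N)) :
    pairing γ (MonoidAlgebra.of ℤ _ x - MonoidAlgebra.of ℤ _ y) = γ x.toList - γ y.toList := by
  rw [pairing, MonoidAlgebra.coeff_sub, Finsupp.sum_sub_index (by intros; ring)]
  simp [MonoidAlgebra.of, MonoidAlgebra.coeff_single]

/-- The two-sided ideal also contains `p * (x - y) * s`, and its pairing with the indicator of `W`
is the difference of the two membership indicators. -/
theorem syntacticCon_of_kronRelator (hW : indicatorSum W ∈ perp (Ikron N))
    {x y : FreeMonoid (Letter N)}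
    (h : KronRelator (MonoidAlgebra.of ℤ _ x - MonoidAlgebra.of ℤ _ y)) : syntacticCon W x y := by
  rw [syntacticCon_def]
  intro p s
  have h1 : MonoidAlgebra.of ℤ _ p * (MonoidAlgebra.of ℤ _ x - MonoidAlgebra.of ℤ _ y) *
      MonoidAlgebra.of ℤ _ s ∈ Ikron N :=
    TwoSidedIdeal.mul_mem_right _ _ _ (TwoSidedIdeal.mul_mem_left _ _ _
      (TwoSidedIdeal.subset_span h))
  rw [mul_sub, sub_mul, ← map_mul, ← map_mul, ← map_mul, ← map_mul] at h1
  have h2 := hW _ h1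
  rw [pairing_of_sub_of] at h2
  generalize (p * x * s).toList = w at h2 ⊢
  generalize (p * y * s).toList = w' at h2 ⊢
  by_cases h3 : w ∈ W <;> by_cases h4 : w' ∈ W <;>
    simp [indicatorSum, h3, h4] at h2 ⊢

theorem letterClass_eq₃ (hW : indicatorSum W ∈ perp (Ikron N)) {x y z x' y' z' : Letter N}
    (h : KronRelator (u x * u y * u z - u x' * u y' * u z')) :
    letterClass W x * letterClass W y * letterClass W z =
      letterClass W x' * letterClass W y' * letterClass W z' := by
  change ((FreeMonoid.of x * FreeMonoid.of y * FreeMonoid.of z : FreeMonoid (Letter N)) :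
    (syntacticCon W).Quotient) = ((FreeMonoid.of x' * FreeMonoid.of y' * FreeMonoid.of z' :
    FreeMonoid (Letter N)) : (syntacticCon W).Quotient)
  rw [Con.eq]
  apply syntacticCon_of_kronRelator hW
  simpa only [map_mul, u] using h

theorem letterClass_eq₂ (hW : indicatorSum W ∈ perp (Ikron N)) {x y x' y' : Letter N}
    (h : KronRelator (u x * u y - u x' * u y')) :
    letterClass W x * letterClass W y = letterClass W x' * letterClass W y' := by
  change ((FreeMonoid.of x * FreeMonoid.of y : FreeMonoid (Letter N)) :
    (syntacticCon W).Quotient) = ((FreeMonoid.of x' * FreeMonoid.of y' :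
    FreeMonoid (Letter N)) : (syntacticCon W).Quotient)
  rw [Con.eq]
  apply syntacticCon_of_kronRelator hW
  simpa only [map_mul, u] using h

/-- The classes of the unbarred letters, continued by `1`. -/
def unbarredClass (W : Set (Word N)) (n : ℕ) : (syntacticCon W).Quotient :=
  if h : n < N then letterClass W (.unbarred ⟨n, h⟩) else 1

/-- The classes of the barred letters, continued by `1`. -/
def barredClass (W : Set (Word N)) (n : ℕ) : (syntacticCon W).Quotient :=
  if h : n < N then letterClass W (.barred ⟨n, h⟩) else 1

/-- Continuing by `1` is harmless: a relation becomes trivial as soon as its larger index is out of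
range. -/
theorem localPlactic_unbarredClass (hW : indicatorSum W ∈ perp (Ikron N)) :
    LocalPlactic (unbarredClass W) := by
  constructor
  · intro x z hxz
    by_cases hz : z < N
    · have hx : x < N := by omega
      simp only [unbarredClass, dif_pos hx, dif_pos hz]
      refine letterClass_eq₂ hW (.farCommute _ _ (.unbarred ⟨z - 1, by omega⟩) ?_ ?_)
      · have : z ≠ 0 := by omega
        simp [down₂, down, this]
      · simp only [natOrder, natRank]; omega
    · simp [unbarredClass, hz]
  · intro x
    by_cases hx : x + 1 < N
    · have hx' : x < N := by omega
      simp only [unbarredClass, dif_pos hx, dif_pos hx']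
      exact letterClass_eq₃ hW (.yyx _ _ rfl (by simp only [natOrder, natRank]; omega))
    · simp [unbarredClass, hx]
  · intro y
    by_cases hx : y + 1 < N
    · have hx' : y < N := by omega
      simp only [unbarredClass, dif_pos hx, dif_pos hx']
      exact letterClass_eq₃ hW (.zyy _ _ rfl (by simp only [natOrder, natRank]; omega))
    · simp [unbarredClass, hx]

/-- The relations for barred `y` are the words of those for unbarred `y` read backwards, hence the
opposite monoid. -/
theorem localPlactic_barredClass (hW : indicatorSum W ∈ perp (Ikron N)) :
    LocalPlactic (fun n => op (barredClass W n)) := by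
  constructor
  · intro x z hxz
    rw [← op_mul, ← op_mul, op_inj]
    by_cases hz : z < N
    · have hx : x < N := by omega
      simp only [barredClass, dif_pos hx, dif_pos hz]
      refine (letterClass_eq₂ hW (.farCommute _ _ (.barred ⟨z - 1, by omega⟩) ?_ ?_)).symm
      · have : z ≠ 0 := by omega
        simp [down₂, down, this]
      · simp only [natOrder, natRank]; omega
    · simp [barredClass, hz]
  · intro x
    simp only [← op_mul, op_inj, ← mul_assoc]
    by_cases hx : x + 1 < N
    · have hx' : x < N := by omega
      simp only [barredClass, dif_pos hx, dif_pos hx']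
      exact letterClass_eq₃ hW (.xyy _ _ rfl (by simp only [natOrder, natRank]; omega))
    · simp [barredClass, hx]
  · intro y
    simp only [← op_mul, op_inj, ← mul_assoc]
    by_cases hx : y + 1 < N
    · have hx' : y < N := by omega
      simp only [barredClass, dif_pos hx, dif_pos hx']
      exact letterClass_eq₃ hW (.yyz _ _ rfl (by simp only [natOrder, natRank]; omega))
    · simp [barredClass, hx]

theorem val_unbarredClass (x : Letter N) :
    x.val (unbarredClass W) = if x.isBarred then 1 else letterClass W x := by
  rcases x with x | x
  · simp [Letter.val, Letter.unbarred?, unbarredClass, Letter.isBarred]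
  · rfl

theorem barVal_barredClass (x : Letter N) :
    x.barVal (barredClass W) = if x.isBarred then letterClass W x else 1 := by
  rcases x with x | x
  · rfl
  · simp [Letter.barVal, Letter.flip, Letter.val, Letter.unbarred?, barredClass, Letter.isBarred]

theorem prod_letterClass_eq_mul (hW : ShuffleClosed W) (w : Word N) :
    (w.map (letterClass W)).prod = (w.map (Letter.val (unbarredClass W))).prod *
      (w.map (Letter.barVal (barredClass W))).prod := by
  induction w with
  | nil => simp
  | cons x w ih =>
    simp only [List.map_cons, List.prod_cons, ih, val_unbarredClass, barVal_barredClass]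
    rcases hx : x.isBarred with _ | _
    · simp [mul_assoc]
    · have hc : Commute (w.map (Letter.val (unbarredClass W))).prod (letterClass W x) := by
        apply commute_prod
        intro y hy
        obtain ⟨y, _, rfl⟩ := List.mem_map.mp hy
        rw [val_unbarredClass]
        rcases hy : y.isBarred with _ | _
        · exact letterClass_commute hW (by simp [hx, hy])
        · exact Commute.one_left _
      simp only [if_true, one_mul]
      rw [← mul_assoc, ← mul_assoc, hc.eq]

/-- Conversion from the big bar order to the natural order preserves membership of the reading
word in `W`. -/
theorem sqread_mem_iff (hW : ShuffleClosed W) (hW' : indicatorSum W ∈ perp (Ikron N))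
    {T T' : Filling N ν} (hT : IsColored (bigBarOrder N) T)
    (h : ConvertsTo (bigBarOrder N) (natOrder N) T T') : sqread T ∈ W ↔ sqread T' ∈ W := by
  apply mem_iff_of_prod_letterClass_eq
  rw [prod_letterClass_eq_mul hW, prod_letterClass_eq_mul hW]
  -- The two factors are treated along different sequences of swaps; independence of the sequence
  -- ensures that both end at the given `T'`.
  congr 1
  · obtain ⟨T₁, h1, h2⟩ := exists_downSteps (P := ClearSwap)
      (fun _ _ ⟨b, a, h, _⟩ => ⟨b, a, h⟩)
      (reflTransGen_clearSwap (natOrder N) sparseBarred_natOrder) hT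
    obtain rfl : T₁ = T' := convertsTo_unique hT
      (ReflTransGen.mono (fun _ _ h => h.1.convertStep) _ _ h2) h
    exact prod_sqread_eq (localPlactic_unbarredClass hW') h2 hT h1 sparseBarred_bigBarOrder
      sparseBarred_natOrder
  · obtain ⟨T₁, h1, h2⟩ := exists_downSteps (P := ClearSwapBarred)
      (fun _ _ ⟨b, a, h, _⟩ => ⟨b, a, h⟩)
      (reflTransGen_clearSwapBarred (natOrder N) sparseUnbarred_natOrder) hT
    obtain rfl : T₁ = T' := convertsTo_unique hT
      (ReflTransGen.mono (fun _ _ h => h.1.convertStep) _ _ h2) h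
    exact prod_sqread_barVal_eq (localPlactic_barredClass hW') h2 hT h1
      sparseUnbarred_bigBarOrder sparseUnbarred_natOrder

theorem exists_convertsTo {T : Filling N ν} (hT : IsColored (bigBarOrder N) T) :
    ∃ T', IsColored (natOrder N) T' ∧ ConvertsTo (bigBarOrder N) (natOrder N) T T' := by
  obtain ⟨T₁, h1, h2⟩ := exists_downSteps (fun _ _ h => h)
    (reflTransGen_differBySwap (natOrder N)) hT
  exact ⟨T₁, h1, ReflTransGen.mono (fun _ _ h => h.1.convertStep) _ _ h2⟩

theorem exists_convertsTo_symm {T' : Filling N ν} (hT' : IsColored (natOrder N) T') :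
    ∃ T, IsColored (bigBarOrder N) T ∧ ConvertsTo (bigBarOrder N) (natOrder N) T T' := by
  obtain ⟨T₁, h1, h2⟩ := exists_downSteps_symm (reflTransGen_differBySwap (natOrder N)) hT'
  exact ⟨T₁, h1, ReflTransGen.mono (fun _ _ h => h.convertStep) _ _ h2⟩

end ColoredTableaux

/-- Conversion from `≺`-colored tableaux to `<`-colored tableaux is well defined (independent of
the sequence of swaps), and it maps `{T ∈ CT_ν^≺ ∣ sqread(T) ∈ W}` onto
`{T ∈ CT_ν^< ∣ sqread(T) ∈ W}`. -/
theorem theorem3p10 (N : ℕ) (ν : YoungDiagram) (W : Set (ColoredTableaux.Word N))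
    (hshuffle : ColoredTableaux.ShuffleClosed W)
    (hperp : ColoredTableaux.indicatorSum W ∈ ColoredTableaux.perp (ColoredTableaux.Ikron N)) :
    (∀ T ∈ ColoredTableaux.CT (ColoredTableaux.bigBarOrder N) ν,
      ∃! T' : ColoredTableaux.Filling N ν,
        ColoredTableaux.ConvertsTo (ColoredTableaux.bigBarOrder N) (ColoredTableaux.natOrder N)
          T T') ∧
    {T' : ColoredTableaux.Filling N ν |
        ∃ T ∈ ColoredTableaux.CT (ColoredTableaux.bigBarOrder N) ν,
          ColoredTableaux.sqread T ∈ W ∧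
          ColoredTableaux.ConvertsTo (ColoredTableaux.bigBarOrder N) (ColoredTableaux.natOrder N)
            T T'} =
      {T' ∈ ColoredTableaux.CT (ColoredTableaux.natOrder N) ν |
        ColoredTableaux.sqread T' ∈ W} := by
  refine ⟨fun T hT => ?_, ?_⟩
  · obtain ⟨T', _, h⟩ := ColoredTableaux.exists_convertsTo hT
    exact ⟨T', h, fun T'' h' => ColoredTableaux.convertsTo_unique hT h' h⟩
  · ext T'
    constructor
    · rintro ⟨T, hT, hTW, h⟩
      obtain ⟨T₁, h1, h2⟩ := ColoredTableaux.exists_convertsTo hT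
      obtain rfl := ColoredTableaux.convertsTo_unique hT h2 h
      exact ⟨h1, (ColoredTableaux.sqread_mem_iff hshuffle hperp hT h).mp hTW⟩
    · rintro ⟨hT', hTW⟩
      obtain ⟨T, hT, h⟩ := ColoredTableaux.exists_convertsTo_symm hT'
      exact ⟨T, hT, (ColoredTableaux.sqread_mem_iff hshuffle hperp hT h).mpr hTW, h⟩
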